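/- Let $\mathcal C$ be a fusion category over an algebraically closed field $\Bbbk$, that is, a $\Bbbk$-linear abelian rigid monoidal category with bilinear tensor product and finite-dimensional morphism spaces which is semisimple, has finitely many isomorphism classes of simple objects, and has a simple unit object. Let $[\mathcal C]$ be its Grothendieck ring, and let $\operatorname{FPdim}(X)$ be the Frobenius--Perron dimension of an object $X$, i.e. the largest non-negative real eigenvalue of the matrix of left multiplication by $[X]$ on $[\mathcal C]$ in the basis of simple objects. For an object $\Pi$ let $\Pi^*$ be its dual with evaluation $\Pi\otimes\Pi^*\to\mathbb 1$. Let $Q$ be a fusion quiver over $\mathcal C$: a finite vertex set $V$, a finite edge set $E$, source and target maps $s,t\colon E\to V$, and an object $\Pi_e$ of $\mathcal C$ for each $e\in E$. For $v,w\in V$ put $\langle\alpha_v,\alpha_v\rangle_Q=2$ and, if $v\ne w$, $$\langle\alpha_v,\alpha_w\rangle_Q=-\sum_{e\colon v\to w}[\Pi_e^*]-\sum_{e\colon w\to v}[\Pi_e]\in[\mathcal C],$$ and extend this to a right $[\mathcal C]$-linear form in the second variable on the free right module $[\mathcal C]^V$ with basis $(\alpha_v)_{v\in V}$. Let $\sigma_v^Q\in\mathrm{GL}_V([\mathcal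 C])$ be the matrix of $m\mapsto m-\alpha_v\langle\alpha_v,m\rangle_Q$, and let $\mathbb W(Q)\subseteq \mathrm{GL}_V([\mathcal C])$ be the subgroup generated by the $\sigma_v^Q$, $v\in V$. Let $\sigma_v^{|Q|}\in \mathrm{GL}_V(\mathbb R)$ and $\mathbb W(|Q|)\subseteq\mathrm{GL}_V(\mathbb R)$ be defined in the same way from the real form $\langle-,-\rangle_{|Q|}$ obtained by replacing each class $[X]$ in these formulas by $\operatorname{FPdim}(X)$. Let $\Gamma_Q$ be the Coxeter graph with vertex set $V$ in which, for $v\neq w$ and $d_{vw}=\sum_{e}\operatorname{FPdim}(\Pi_e)$ (sum over all edges $e$ joining $v$ and $w$, in either direction), the label of $\{v,w\}$ is the integer $m\ge2$ with $d_{vw}=2\cos(\pi/m)$ if $d_{vw}<2$, and $\infty$ if $d_{vw}\ge2$ (the label $2$ means that there is no edge). Let $\mathbb W(\Gamma_Q)$ be its Coxeter group, with simple reflections $\sigma_v$, $v\in V$. Then $X\mapsto\operatorname{FPdim}(X)$ induces a ring homomorphism $\operatorname{FPdim}\colon[\mathcal C]\to\mathbb R$, and there are group isomorphisms $$\mathbb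 W(\Gamma_Q)\xrightarrow{\ \sim\ }\mathbb W(Q)\xrightarrow{\ \sim\ }\mathbb W(|Q|),\qquad \sigma_v\mapsto\sigma_v^Q\mapsto\sigma_v^{|Q|}\quad(v\in V),$$ the second of which is given by applying $\operatorname{FPdim}$ to each matrix entry. -/

import Mathlib

open CategoryTheory MonoidalCategory

universe v u w

noncomputable section

/-! ### Fusion categories -/

section

attribute [local instance] Abelian.hasFiniteBiproducts

/-- A `k`-linear abelian rigid monoidal category (with bilinear tensor product) is a *fusion
category* if its morphism spaces are finite-dimensional, its unit object is simple, it is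
semisimple, and it has finitely many isomorphism classes of simple objects. -/
class FusionCategory (k : Type w) [Field k] (C : Type u) [Category.{v} C] [Abelian C]
    [Linear k C] [MonoidalCategory C] [MonoidalPreadditive C] [MonoidalLinear k C]
    [RigidCategory C] : Prop where
  finite_hom : ∀ X Y : C, FiniteDimensional k (X ⟶ Y)
  simple_unit : Simple (𝟙_ C)
  semisimple : ∀ X : C, ∃ (n : ℕ) (S : Fin n → C),
    (∀ i, Simple (S i)) ∧ Nonempty (X ≅ ⨁ S)
  finite_simples : Finite {x : Skeleton C // Simple x.out}

end

/-! ### The Grothendieck ring -/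

section Grothendieck

variable (C : Type u) [Category.{v} C] [Abelian C] [MonoidalCategory C]

/-- The subgroup of the free abelian group on isomorphism classes of objects generated by the
elements `[X₂] - [X₁] - [X₃]`, for all short exact sequences `0 ⟶ X₁ ⟶ X₂ ⟶ X₃ ⟶ 0`. -/
def exactRelations : AddSubgroup (FreeAbelianGroup (Skeleton C)) :=
  AddSubgroup.closure {z | ∃ S : ShortComplex C, S.ShortExact ∧
    z = FreeAbelianGroup.of (toSkeleton S.X₂) - FreeAbelianGroup.of (toSkeleton S.X₁)
      - FreeAbelianGroup.of (toSkeleton S.X₃)}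

variable {C}
variable [MonoidalPreadditive C] [RigidCategory C]

theorem shortExact_tensorLeft (X : C) {S : ShortComplex C} (hS : S.ShortExact) :
    (S.map (tensorLeft X)).ShortExact := by
  have : (tensorLeft X).IsLeftAdjoint :=
    (tensorLeftAdjunction (HasLeftDual.leftDual X) X).isLeftAdjoint
  have : (tensorLeft X).IsRightAdjoint :=
    (tensorLeftAdjunction X (HasRightDual.rightDual X)).isRightAdjoint
  exact hS.map_of_exact (tensorLeft X)

theorem shortExact_tensorRight (X : C) {S : ShortComplex C} (hS : S.ShortExact) :
    (S.map (tensorRight X)).ShortExact := by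
  have : (tensorRight X).IsLeftAdjoint :=
    (tensorRightAdjunction X (HasRightDual.rightDual X)).isLeftAdjoint
  have : (tensorRight X).IsRightAdjoint :=
    (tensorRightAdjunction (HasLeftDual.leftDual X) X).isRightAdjoint
  exact hS.map_of_exact (tensorRight X)

theorem exactRelations_mul_left (a : FreeAbelianGroup (Skeleton C))
    {z : FreeAbelianGroup (Skeleton C)} (hz : z ∈ exactRelations C) :
    a * z ∈ exactRelations C := by
  induction a using FreeAbelianGroup.induction_on with
  | zero => simp
  | of x =>
    refine AddSubgroup.closure_induction (p := fun z _ =>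
      FreeAbelianGroup.of x * z ∈ exactRelations C) ?_ ?_ ?_ ?_ hz
    · rintro z ⟨S, hS, rfl⟩
      obtain ⟨X, rfl⟩ : ∃ X : C, toSkeleton X = x := ⟨x.out, Quotient.out_eq x⟩
      refine AddSubgroup.subset_closure ⟨_, shortExact_tensorLeft X hS, ?_⟩
      simp [mul_sub, FreeAbelianGroup.of_mul_of, ← Skeleton.toSkeleton_tensorObj]
    · simp
    · intro y z _ _ hy hz
      simpa [mul_add] using (exactRelations C).add_mem hy hz
    · intro y _ hy
      simpa using (exactRelations C).neg_mem hy
  | neg x h => simpa using (exactRelations C).neg_mem h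
  | add x y hx hy => simpa [add_mul] using (exactRelations C).add_mem hx hy

theorem exactRelations_mul_right (a : FreeAbelianGroup (Skeleton C))
    {z : FreeAbelianGroup (Skeleton C)} (hz : z ∈ exactRelations C) :
    z * a ∈ exactRelations C := by
  induction a using FreeAbelianGroup.induction_on with
  | zero => simp
  | of x =>
    refine AddSubgroup.closure_induction (p := fun z _ =>
      z * FreeAbelianGroup.of x ∈ exactRelations C) ?_ ?_ ?_ ?_ hz
    · rintro z ⟨S, hS, rfl⟩
      obtain ⟨X, rfl⟩ : ∃ X : C, toSkeleton X = x := ⟨x.out, Quotient.out_eq x⟩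
      refine AddSubgroup.subset_closure ⟨_, shortExact_tensorRight X hS, ?_⟩
      simp [sub_mul, FreeAbelianGroup.of_mul_of, ← Skeleton.toSkeleton_tensorObj]
    · simp
    · intro y z _ _ hy hz
      simpa [add_mul] using (exactRelations C).add_mem hy hz
    · intro y _ hy
      simpa using (exactRelations C).neg_mem hy
  | neg x h => simpa using (exactRelations C).neg_mem h
  | add x y hx hy => simpa [mul_add] using (exactRelations C).add_mem hx hy

variable (C)

/-- The exact-sequence relations form an ideal, because the tensor product is exact. -/
def exactIdeal : Ideal (FreeAbelianGroup (Skeleton C)) where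
  carrier := exactRelations C
  zero_mem' := (exactRelations C).zero_mem
  add_mem' := (exactRelations C).add_mem
  smul_mem' a _ hz := exactRelations_mul_left a hz

instance exactIdeal_isTwoSided : (exactIdeal C).IsTwoSided :=
  ⟨fun b hz => exactRelations_mul_right b hz⟩

/-- The Grothendieck ring `[C]`: the Grothendieck group of the abelian category `C`, with the
multiplication `[X] * [Y] = [X ⊗ Y]` and the unit `[𝟙_ C]`. -/
abbrev GrothendieckRing : Type u := FreeAbelianGroup (Skeleton C) ⧸ exactIdeal C

variable {C}

/-- The class `[X]` of an object in the Grothendieck ring. -/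
def GrothendieckRing.cls (X : C) : GrothendieckRing C :=
  Ideal.Quotient.mk (exactIdeal C) (FreeAbelianGroup.of (toSkeleton X))

end Grothendieck

/-! ### Frobenius-Perron dimension -/

section FPdim

variable (k : Type w) [Field k] {C : Type u} [Category.{v} C] [Abelian C] [Linear k C]
  [MonoidalCategory C] [MonoidalPreadditive C] [MonoidalLinear k C] [RigidCategory C]

variable (C) in
/-- The finite set of isomorphism classes of simple objects (each with its representative). -/
abbrev IrrObj : Type u := {x : Skeleton C // Simple x.out}

theorem finite_irrObj [h : FusionCategory k C] : Finite (IrrObj C) := h.finite_simples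

/-- The matrix of left tensoring with `X` in the basis of simple objects: the entry at `(i, j)` is
the multiplicity of the simple object `S_i` in `X ⊗ S_j`. -/
def fusionMatrix (X : C) : Matrix (IrrObj C) (IrrObj C) ℝ :=
  Matrix.of fun i j => (Module.finrank k (i.1.out ⟶ X ⊗ j.1.out) : ℝ)

/-- The Frobenius-Perron eigenvalue of a square matrix with non-negative entries: its largest
non-negative real eigenvalue. -/
def frobeniusPerronEigenvalue {n : Type*} [Fintype n] [DecidableEq n] (A : Matrix n n ℝ) : ℝ :=
  sSup {r : ℝ | 0 ≤ r ∧ Module.End.HasEigenvalue (Matrix.toLin' A) r}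

open Classical in
/-- The Frobenius-Perron dimension of an object of a fusion category. -/
def FPdim [FusionCategory k C] (X : C) : ℝ :=
  haveI : Fintype (IrrObj C) := @Fintype.ofFinite _ (finite_irrObj k)
  frobeniusPerronEigenvalue (fusionMatrix k X)

end FPdim

/-! ### Groups generated by reflections -/

section Reflections

variable {R : Type*} [Ring R] {V : Type*} [Fintype V] [DecidableEq V]

/-- The matrix of `m ↦ m - ⟨α_v, m⟩ α_v`, acting on column vectors by left multiplication, where
`⟨α_v, α_w⟩ = B v w` and the form is linear for the right action of `R` in the second variable:
the identity matrix minus the matrix whose `v`-th row is that of `B`, other rows being zero. -/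
def reflectionMatrix (B : Matrix V V R) (v : V) : Matrix V V R :=
  1 - Matrix.of fun i j => if i = v then B v j else 0

theorem reflectionMatrix_mul_self (B : Matrix V V R) (v : V) (h : B v v = 2) :
    reflectionMatrix B v * reflectionMatrix B v = 1 := by
  have key : (Matrix.of fun i j => if i = v then B v j else 0 : Matrix V V R) *
      (Matrix.of fun i j => if i = v then B v j else 0)
      = 2 • (Matrix.of fun i j => if i = v then B v j else 0) := by
    ext i j
    by_cases hi : i = v <;> simp [Matrix.mul_apply, hi, h, two_mul, two_smul]
  unfold reflectionMatrix
  rw [sub_mul, mul_sub, mul_sub, key]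
  simp only [one_mul, mul_one, two_smul]
  abel

/-- The reflection at `v`, as an element of `GL_V(R)`. -/
def reflection (B : Matrix V V R) (hB : ∀ v, B v v = 2) (v : V) : Matrix.GeneralLinearGroup V R where
  val := reflectionMatrix B v
  inv := reflectionMatrix B v
  val_inv := reflectionMatrix_mul_self B v (hB v)
  inv_val := reflectionMatrix_mul_self B v (hB v)

/-- The subgroup of `GL_V(R)` generated by the reflections at all `v`. -/
def reflectionGroup (B : Matrix V V R) (hB : ∀ v, B v v = 2) :
    Subgroup (Matrix.GeneralLinearGroup V R) :=
  Subgroup.closure (Set.range (reflection B hB))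

end Reflections

/-! ### Fusion quivers -/

/-- A fusion quiver over `C` with vertex set `V` and edge set `E`: a quiver, with an object of `C`
attached to each edge. -/
structure FusionQuiver (C : Type u) (V E : Type*) where
  src : E → V
  tgt : E → V
  label : E → C

namespace FusionQuiver

variable {C : Type u} [Category.{v} C] [Abelian C] [MonoidalCategory C] [MonoidalPreadditive C]
  [RigidCategory C] {V E : Type*} [Fintype V] [DecidableEq V] [Fintype E] (Q : FusionQuiver C V E)

/-- The matrix with entry `2` at `(v, v)` and, for `v ≠ w`, with entry
`- ∑_{e : v → w} d(Π_e^*) - ∑_{e : w → v} d(Π_e)` at `(v, w)`, where `d` is a function on the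
objects of `C` and where `Π^*` is the dual with an evaluation map `Π ⊗ Π^* ⟶ 𝟙_ C` (Mathlib calls
it the left dual). -/
def gram {R : Type*} [Ring R] (d : C → R) : Matrix V V R := Matrix.of fun v w =>
  if v = w then 2
  else - (∑ e : E with Q.src e = v ∧ Q.tgt e = w, d (HasLeftDual.leftDual (Q.label e)))
    - ∑ e : E with Q.src e = w ∧ Q.tgt e = v, d (Q.label e)

theorem gram_self {R : Type*} [Ring R] (d : C → R) (v : V) : Q.gram d v v = 2 := by
  simp [gram]

/-- The Gram matrix `⟨α_v, α_w⟩_Q` of the `[C]`-valued form on `[C]^V`. -/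
def form : Matrix V V (GrothendieckRing C) := Q.gram GrothendieckRing.cls

/-- The reflection `σ_v^Q` in `GL_V([C])`. -/
def sigma (v : V) : Matrix.GeneralLinearGroup V (GrothendieckRing C) :=
  reflection Q.form (Q.gram_self _) v

/-- The reflection group `W(Q)` in `GL_V([C])`, generated by the `σ_v^Q`. -/
def W : Subgroup (Matrix.GeneralLinearGroup V (GrothendieckRing C)) :=
  reflectionGroup Q.form (Q.gram_self _)

theorem sigma_mem (v : V) : Q.sigma v ∈ Q.W :=
  Subgroup.subset_closure (Set.mem_range_self v)

variable (k : Type w) [Field k] [Linear k C] [MonoidalLinear k C] [FusionCategory k C]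

/-- The Gram matrix `⟨α_v, α_w⟩_{|Q|}` of the real form on `ℝ^V`. -/
def realForm : Matrix V V ℝ := Q.gram (FPdim k)

/-- The real reflection `σ_v^{|Q|}` in `GL_V(ℝ)`. -/
def realSigma (v : V) : Matrix.GeneralLinearGroup V ℝ :=
  reflection (Q.realForm k) (Q.gram_self _) v

/-- The real reflection group `W(|Q|)` in `GL_V(ℝ)`, generated by the `σ_v^{|Q|}`. -/
def realW : Subgroup (Matrix.GeneralLinearGroup V ℝ) :=
  reflectionGroup (Q.realForm k) (Q.gram_self _)

theorem realSigma_mem (v : V) : Q.realSigma k v ∈ Q.realW k :=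
  Subgroup.subset_closure (Set.mem_range_self v)

/-- The label of `{v, w}` in the underlying labeled graph `|Q|`: the sum of the dimensions
`FPdim(Π_e)` over all edges `e` joining `v` and `w`, in either direction (zero if there is none). -/
def graphLabel (v w : V) : ℝ :=
  ∑ e : E with (Q.src e = v ∧ Q.tgt e = w) ∨ (Q.src e = w ∧ Q.tgt e = v), FPdim k (Q.label e)

theorem graphLabel_comm (v w : V) : Q.graphLabel k v w = Q.graphLabel k w v := by
  unfold graphLabel
  congr 1
  ext e
  simp [or_comm]

/-- The Coxeter label of a real number `d ≥ 0`: the `m ≥ 2` with `d = 2 cos (π / m)` if `d < 2`,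
and `∞` if `d ≥ 2`. In Mathlib's Coxeter matrices `∞` is encoded as `0`. -/
def coxeterLabel (d : ℝ) : ℕ :=
  if 2 ≤ d then 0 else sInf {m : ℕ | 2 ≤ m ∧ d = 2 * Real.cos (Real.pi / m)}

theorem coxeterLabel_ne_one (d : ℝ) : coxeterLabel d ≠ 1 := by
  unfold coxeterLabel
  split_ifs
  · exact zero_ne_one
  · intro h
    have hne := Nat.nonempty_of_sInf_eq_succ h
    have := (Nat.sInf_mem hne).1
    omega

/-- The Coxeter graph `Γ_Q`, as a Coxeter matrix (the entry `2` means that there is no edge). -/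
def coxeterGraph : CoxeterMatrix V where
  M := Matrix.of fun v w => if v = w then 1 else coxeterLabel (Q.graphLabel k v w)
  isSymm := by
    ext v w
    simp only [Matrix.transpose_apply, Matrix.of_apply, Q.graphLabel_comm k v w, eq_comm]
  diagonal v := by simp
  off_diagonal v w h := by simpa [h] using coxeterLabel_ne_one _

end FusionQuiver

end

/-! Letting each entry act by left multiplication in the basis of simple objects turns a matrix over
[C] into a real matrix on V × Irr(C) (`expand`). Duals become transposes, so the form becomes a
symmetric integral matrix with 2 on the diagonal and nonpositive entries elsewhere, which is a
geometric form for a Coxeter group with labels 2, 3, ∞ (`isGeometricForm_expand_form`). Each σ_v^Q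
becomes the product of the mutually orthogonal reflections at the (v, i) (`expand_mem`). Thus W(Q)
embeds in an ordinary reflection group, where every column of every element has constant sign
(`col_nonneg_aux`).

All left multiplications share a positive eigenvector d, on both sides (`exists_character`,
`vecMul_character`). Weighting the rows of an expanded matrix by d gives, up to a positive factor,
the FPdim of its entries, so the column signs descend to W(|Q|). If FPdim sends g ∈ W(Q) to the
identity, no column of its expansion can be nonpositive; so the expansion is nonnegative, and g = 1.
Hence W(Q) ≅ W(|Q|).

Constant column signs in W(|Q|), read in a dihedral subgroup, force each d_vw < 2 to be 2 cos(π/m)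
(`exists_eq_two_mul_cos`). The real form is therefore a geometric form for Γ_Q, and faithfulness of
the geometric representation (`rep_injective`) gives W(Γ_Q) ≅ W(|Q|). -/

noncomputable section

/-! ### Rank two computations -/

/-- The sequence `0, 1, b, b² - 1, …` of (shifted) Chebyshev polynomials of the second kind,
evaluated at `b / 2`. -/
def chebyshevSeq (b : ℝ) : ℕ → ℝ
  | 0 => 0
  | 1 => 1
  | n + 2 => b * chebyshevSeq b (n + 1) - chebyshevSeq b n

theorem chebyshevSeq_two_mul_cos (θ : ℝ) (n : ℕ) :
    Real.sin θ * chebyshevSeq (2 * Real.cos θ) n = Real.sin (n * θ) := by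
  induction n using Nat.twoStepInduction with
  | zero => simp [chebyshevSeq]
  | one => simp [chebyshevSeq]
  | more n h₁ h₂ =>
    have e₁ : ((n + 2 : ℕ) : ℝ) * θ = (n + 1 : ℕ) * θ + θ := by push_cast; ring
    have e₂ : (n : ℝ) * θ = (n + 1 : ℕ) * θ - θ := by push_cast; ring
    rw [chebyshevSeq, e₁, Real.sin_add]
    rw [e₂, Real.sin_sub] at h₁
    linear_combination (2 * Real.cos θ) * h₂ - h₁

theorem chebyshevSeq_eq_div {θ : ℝ} (hθ : Real.sin θ ≠ 0) (n : ℕ) :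
    chebyshevSeq (2 * Real.cos θ) n = Real.sin (n * θ) / Real.sin θ := by
  rw [eq_div_iff hθ, mul_comm, chebyshevSeq_two_mul_cos]

/-- For b ≥ 2 the sequence is nondecreasing; nonnegativity and monotonicity need each other in the
induction. -/
theorem chebyshevSeq_nonneg_of_two_le {b : ℝ} (hb : 2 ≤ b) (n : ℕ) : 0 ≤ chebyshevSeq b n := by
  have key : ∀ n, 0 ≤ chebyshevSeq b n ∧ chebyshevSeq b n ≤ chebyshevSeq b (n + 1) := by
    intro n
    induction n with
    | zero => simp [chebyshevSeq]
    | succ n ih =>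
      refine ⟨ih.1.trans ih.2, ?_⟩
      rw [chebyshevSeq]
      nlinarith [ih.1.trans ih.2]
  exact (key n).1

theorem sin_pi_div_pos {m : ℕ} (hm : 2 ≤ m) : 0 < Real.sin (Real.pi / m) := by
  have hm' : (2 : ℝ) ≤ m := by exact_mod_cast hm
  refine Real.sin_pos_of_pos_of_lt_pi (by positivity) ?_
  rw [div_lt_iff₀ (by positivity)]
  nlinarith [Real.pi_pos]

/-- The value is sin(nπ/m) / sin(π/m), and the angle nπ/m has not passed π. -/
theorem chebyshevSeq_nonneg_of_le {m n : ℕ} (hm : 2 ≤ m) (hn : n ≤ m) :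
    0 ≤ chebyshevSeq (2 * Real.cos (Real.pi / m)) n := by
  have hm' : (2 : ℝ) ≤ m := by exact_mod_cast hm
  have hn' : (n : ℝ) ≤ m := by exact_mod_cast hn
  rw [chebyshevSeq_eq_div (sin_pi_div_pos hm).ne']
  refine div_nonneg (Real.sin_nonneg_of_nonneg_of_le_pi (by positivity) ?_) (sin_pi_div_pos hm).le
  rw [mul_div_assoc', div_le_iff₀ (by positivity)]
  nlinarith [Real.pi_pos]

theorem chebyshevSeq_two_mul {m : ℕ} (hm : 2 ≤ m) :
    chebyshevSeq (2 * Real.cos (Real.pi / m)) (2 * m) = 0 ∧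
      chebyshevSeq (2 * Real.cos (Real.pi / m)) (2 * m + 1) = 1 := by
  have hm' : (m : ℝ) ≠ 0 := by positivity
  have h := (sin_pi_div_pos hm).ne'
  rw [chebyshevSeq_eq_div h, chebyshevSeq_eq_div h]
  have e₁ : ((2 * m : ℕ) : ℝ) * (Real.pi / m) = 2 * Real.pi := by
    push_cast; field_simp
  have e₂ : ((2 * m + 1 : ℕ) : ℝ) * (Real.pi / m) = Real.pi / m + 2 * Real.pi := by
    push_cast; field_simp; ring
  rw [e₁, e₂, Real.sin_add_two_pi, div_self h]
  simp

section Rank2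

variable {I : Type*} [Fintype I] [DecidableEq I] {B : Matrix I I ℝ}

theorem reflectionMatrix_mulVec (B : Matrix I I ℝ) (s : I) (x : I → ℝ) :
    (reflectionMatrix B s).mulVec x = x - (B s ⬝ᵥ x) • Pi.single s 1 := by
  rw [reflectionMatrix, Matrix.sub_mulVec, Matrix.one_mulVec]
  congr 1
  ext i
  by_cases h : i = s
  · subst h; simp [Matrix.mulVec, dotProduct]
  · simp [Matrix.mulVec, dotProduct, h]

theorem reflectionMatrix_mulVec_pair (h : ∀ i, B i i = 2) (s t : I) (x y : ℝ) :
    (reflectionMatrix B s).mulVec (x • Pi.single s 1 + y • Pi.single t 1) =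
      (-x - B s t * y) • Pi.single s 1 + y • Pi.single t 1 := by
  rw [reflectionMatrix_mulVec, dotProduct_add, dotProduct_smul, dotProduct_smul,
    dotProduct_single_one, dotProduct_single_one, h, smul_eq_mul, smul_eq_mul]
  module

/-- `alternatingWord s t k` ends in t, so the first reflection applied to the root of s is σ_t. The
later ones stay in the plane of the two roots, and each runs the Chebyshev recursion once. -/
theorem prod_alternatingWord_mulVec (hB : B.IsSymm) (h : ∀ i, B i i = 2) (s t : I) (k : ℕ) :
    ((CoxeterSystem.alternatingWord s t k).map (reflectionMatrix B)).prod.mulVec (Pi.single s 1) =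
      if Even k then
        chebyshevSeq (-B s t) (k + 1) • Pi.single s 1 + chebyshevSeq (-B s t) k • Pi.single t 1
      else
        chebyshevSeq (-B s t) (k + 1) • Pi.single t 1 + chebyshevSeq (-B s t) k • Pi.single s 1 := by
  induction k with
  | zero =>
    rw [CoxeterSystem.alternatingWord, List.map_nil, List.prod_nil, Matrix.one_mulVec]
    simp [chebyshevSeq]
  | succ k ih =>
    rw [CoxeterSystem.alternatingWord_succ', List.map_cons, List.prod_cons, ← Matrix.mulVec_mulVec,
      ih]
    by_cases hk : Even k
    · rw [if_pos hk, if_pos hk, if_neg (by simpa [Nat.even_add_one] using hk), add_comm,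
        reflectionMatrix_mulVec_pair h, hB.apply s t, chebyshevSeq]
      module
    · rw [if_neg hk, if_neg hk, if_pos (by simpa [Nat.even_add_one] using hk), add_comm,
        reflectionMatrix_mulVec_pair h, chebyshevSeq]
      module

theorem mul_pow_mulVec_single {m : ℕ} (hm : 2 ≤ m) (hB : B.IsSymm) (h : ∀ i, B i i = 2) {s t : I}
    (hst : B s t = -2 * Real.cos (Real.pi / m)) :
    ((reflectionMatrix B s * reflectionMatrix B t) ^ m).mulVec (Pi.single s 1) =
      Pi.single s 1 := by
  have key : ∀ n, ((CoxeterSystem.alternatingWord s t (2 * n)).map (reflectionMatrix B)).prod =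
      (reflectionMatrix B s * reflectionMatrix B t) ^ n := by
    intro n
    induction n with
    | zero => simp [CoxeterSystem.alternatingWord]
    | succ n ih =>
      rw [mul_add, mul_one, CoxeterSystem.alternatingWord_succ', CoxeterSystem.alternatingWord_succ',
        if_neg (by simp), if_pos (by simp), List.map_cons, List.map_cons,
        List.prod_cons, List.prod_cons, ih, pow_succ', mul_assoc]
  have e : -B s t = 2 * Real.cos (Real.pi / m) := by rw [hst]; ring
  rw [← key, prod_alternatingWord_mulVec hB h, if_pos (by simp), e, (chebyshevSeq_two_mul hm).1,
    (chebyshevSeq_two_mul hm).2]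
  simp

/-- The form is nondegenerate on the plane of the two roots, so the space is this plane plus its
orthogonal complement. Both reflections fix the complement, and the m-th power fixes both roots. -/
theorem reflectionMatrix_mul_pow {m : ℕ} (hm : 2 ≤ m) (hB : B.IsSymm) (h : ∀ i, B i i = 2)
    {s t : I} (hst : B s t = -2 * Real.cos (Real.pi / m)) :
    (reflectionMatrix B s * reflectionMatrix B t) ^ m = 1 := by
  set σ := reflectionMatrix B s
  set τ := reflectionMatrix B t
  have hσ : σ * σ = 1 := reflectionMatrix_mul_self B s (h s)
  have hτ : τ * τ = 1 := reflectionMatrix_mul_self B t (h t)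
  have hts : B t s = -2 * Real.cos (Real.pi / m) := by rw [← hst, hB.apply]
  have h₁ : ((σ * τ) ^ m).mulVec (Pi.single s 1) = Pi.single s 1 := mul_pow_mulVec_single hm hB h hst
  -- The root of t is fixed by (τσ)^m, which is the inverse of (στ)^m.
  have h₂ : ((σ * τ) ^ m).mulVec (Pi.single t 1) = Pi.single t 1 := by
    have := mul_pow_mulVec_single hm hB h hts
    conv_lhs => rw [← this]
    have e : σ * τ * (τ * σ) = 1 := by
      rw [mul_assoc, ← mul_assoc τ, hτ, one_mul, hσ]
    have e' : τ * σ * (σ * τ) = 1 := by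
      rw [mul_assoc, ← mul_assoc σ, hσ, one_mul, hτ]
    have hc : Commute (σ * τ) (τ * σ) := e.trans e'.symm
    rw [Matrix.mulVec_mulVec, ← hc.mul_pow, e, one_pow, Matrix.one_mulVec]
  -- The Gram determinant of the plane is 4 sin²(π/m).
  have hdet : 4 - B s t ^ 2 ≠ 0 := by
    have := sin_pi_div_pos hm
    have e := Real.sin_sq_add_cos_sq (Real.pi / m)
    rw [hst]
    nlinarith [pow_pos this 2]
  apply Matrix.toLin'.injective
  refine LinearMap.ext fun x => ?_
  rw [Matrix.toLin'_apply, Matrix.toLin'_apply, Matrix.one_mulVec]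
  set p := B s ⬝ᵥ x
  set q := B t ⬝ᵥ x
  -- Cramer's rule for the coefficients of the orthogonal projection of x to the plane.
  set a := (2 * p - B s t * q) / (4 - B s t ^ 2) with ha
  set c := (2 * q - B s t * p) / (4 - B s t ^ 2) with hc
  have e₁ : 2 * a + B s t * c = p := by rw [ha, hc]; field_simp; ring
  have e₂ : B s t * a + 2 * c = q := by rw [ha, hc]; field_simp; ring
  set y := x - a • Pi.single s 1 - c • Pi.single t 1 with hy
  have hsy : σ.mulVec y = y := by
    rw [reflectionMatrix_mulVec, hy]
    simp only [dotProduct_sub, dotProduct_smul, dotProduct_single_one, h, smul_eq_mul]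
    rw [show B s ⬝ᵥ x - a * 2 - c * B s t = 0 by linear_combination -e₁]
    simp
  have hty : τ.mulVec y = y := by
    rw [reflectionMatrix_mulVec, hy]
    simp only [dotProduct_sub, dotProduct_smul, dotProduct_single_one, h, smul_eq_mul]
    rw [hB.apply s t, show B t ⬝ᵥ x - a * B s t - c * 2 = 0 by linear_combination -e₂]
    simp
  have hpow : ∀ n, ((σ * τ) ^ n).mulVec y = y := by
    intro n
    induction n with
    | zero => simp
    | succ n ih => rw [pow_succ, ← Matrix.mulVec_mulVec, ← Matrix.mulVec_mulVec, hty, hsy, ih]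
  have hx : x = y + a • Pi.single s 1 + c • Pi.single t 1 := by rw [hy]; abel
  rw [hx, Matrix.mulVec_add, Matrix.mulVec_add, Matrix.mulVec_smul, Matrix.mulVec_smul, hpow, h₁, h₂]

end Rank2

/-! ### The geometric representation of a Coxeter group -/

/-- A symmetric real matrix is a *geometric form* for a Coxeter matrix `M` if its diagonal entries
are `2`, and if its entry at `i ≠ j` is `-2 cos (π / M i j)` when `M i j` is finite, and at
most `-2` when `M i j = ∞`. -/
structure CoxeterMatrix.IsGeometricForm {I : Type*} (M : CoxeterMatrix I) (B : Matrix I I ℝ) :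
    Prop where
  symm : B.IsSymm
  diag : ∀ i, B i i = 2
  finite : ∀ i j, i ≠ j → M i j ≠ 0 → B i j = -2 * Real.cos (Real.pi / M i j)
  infinite : ∀ i j, M i j = 0 → B i j ≤ -2

theorem CoxeterMatrix.two_le {I : Type*} (M : CoxeterMatrix I) {i j : I} (hij : i ≠ j)
    (h0 : M i j ≠ 0) : 2 ≤ M i j := by
  have := M.off_diagonal i j hij
  omega

namespace CoxeterMatrix.IsGeometricForm

variable {I : Type*} {M : CoxeterMatrix I} {B : Matrix I I ℝ}

theorem chebyshevSeq_nonneg (h : M.IsGeometricForm B) {i j : I} (hij : i ≠ j) {n : ℕ}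
    (hn : M i j ≠ 0 → n ≤ M i j) : 0 ≤ chebyshevSeq (-B i j) n := by
  by_cases h0 : M i j = 0
  · exact chebyshevSeq_nonneg_of_two_le (by linarith [h.infinite i j h0]) n
  · rw [h.finite i j hij h0, neg_mul, neg_neg]
    exact chebyshevSeq_nonneg_of_le (M.two_le hij h0) (hn h0)

variable [Fintype I] [DecidableEq I]

theorem isLiftable (h : M.IsGeometricForm B) : M.IsLiftable (reflection B h.diag) := by
  intro i j
  ext1
  rw [Units.val_pow_eq_pow_val, Units.val_mul, Units.val_one]
  change (reflectionMatrix B i * reflectionMatrix B j) ^ M i j = 1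
  by_cases hij : i = j
  · subst hij
    rw [M.diagonal, pow_one, reflectionMatrix_mul_self B i (h.diag i)]
  by_cases h0 : M i j = 0
  · rw [h0, pow_zero]
  exact reflectionMatrix_mul_pow (M.two_le hij h0) h.symm h.diag (h.finite i j hij h0)

/-- The geometric representation. -/
def rep (h : M.IsGeometricForm B) : M.Group →* Matrix.GeneralLinearGroup I ℝ :=
  M.toCoxeterSystem.lift ⟨reflection B h.diag, h.isLiftable⟩

theorem rep_simple (h : M.IsGeometricForm B) (i : I) :
    h.rep (M.simple i) = reflection B h.diag i := by
  rw [← M.toCoxeterSystem_simple]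
  exact M.toCoxeterSystem.lift_apply_simple h.isLiftable i

theorem rep_wordProd (h : M.IsGeometricForm B) (ω : List I) :
    (h.rep (M.toCoxeterSystem.wordProd ω)).1 = (ω.map (reflectionMatrix B)).prod := by
  induction ω with
  | nil => simp
  | cons i ω ih =>
    rw [CoxeterSystem.wordProd_cons, map_mul, Units.val_mul, ih, List.map_cons, List.prod_cons,
      M.toCoxeterSystem_simple, h.rep_simple]
    rfl

theorem range_rep (h : M.IsGeometricForm B) : h.rep.range = reflectionGroup B h.diag := by
  rw [reflectionGroup, MonoidHom.range_eq_map, ← M.toCoxeterSystem.subgroup_closure_range_simple,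
    MonoidHom.map_closure, ← Set.range_comp]
  congr 2
  ext1 i
  exact h.rep_simple i

/-- Write w = v·u with lengths adding, u an alternating word in s and a right descent t of w, and u
as long as possible. Then v has neither s nor t as a right descent, so by induction it sends both
roots to nonnegative vectors, while u sends the root of s to a nonnegative combination of the two.
-/
theorem col_nonneg_aux (h : M.IsGeometricForm B) (n : ℕ) :
    ∀ w : M.Group, M.toCoxeterSystem.length w = n → ∀ s, ¬M.toCoxeterSystem.IsRightDescent w s →
      0 ≤ (h.rep w).1.mulVec (Pi.single s 1) := by
  induction n using Nat.strong_induction_on with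
  | _ n ih =>
  intro w hw s hs
  set cs := M.toCoxeterSystem with hcs
  by_cases hw1 : w = 1
  · subst hw1
    rw [map_one, Units.val_one, Matrix.one_mulVec]
    exact Pi.single_nonneg.2 zero_le_one
  obtain ⟨t, ht⟩ := cs.exists_rightDescent_of_ne_one hw1
  have hst : s ≠ t := by rintro rfl; exact hs ht
  classical
  let P : ℕ → Prop := fun k => ∃ v, w = v * cs.wordProd (CoxeterSystem.alternatingWord s t k) ∧
    cs.length v + k = cs.length w
  have hP1 : P 1 := by
    refine ⟨w * cs.simple t, ?_, cs.isRightDescent_iff.1 ht⟩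
    simp [CoxeterSystem.alternatingWord]
  have hPle : ∀ k, P k → k ≤ cs.length w := fun k ⟨v, _, hv⟩ => by omega
  obtain ⟨k, hk1, ⟨v, hwv, hlen⟩, hmax⟩ : ∃ k, 1 ≤ k ∧ P k ∧ ¬P (k + 1) := by
    refine ⟨Nat.findGreatest P (cs.length w), Nat.le_findGreatest (hPle 1 hP1) hP1,
      Nat.findGreatest_spec (hPle 1 hP1) hP1, fun hP => ?_⟩
    have := Nat.le_findGreatest (hPle _ hP) hP
    omega
  have hdesc : ∀ x, x = s ∨ x = t → ¬cs.IsRightDescent v x := by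
    intro x hx hd
    have hd' := cs.isRightDescent_iff.1 hd
    -- A descent x of v either prolongs the alternating word, against maximality, or cancels its
    -- leading letter, giving w an expression that is too short.
    by_cases hxk : x = if Even k then t else s
    · refine hmax ⟨v * cs.simple x, ?_, by omega⟩
      rw [CoxeterSystem.alternatingWord_succ', ← hxk, cs.wordProd_cons, mul_assoc,
        cs.simple_mul_simple_cancel_left, hwv]
    · obtain ⟨j, rfl⟩ : ∃ j, k = j + 1 := ⟨k - 1, by omega⟩
      have hxj : x = if Even j then t else s := by
        by_cases hj : Even j <;> simp [hj, Nat.even_add_one] at hxk ⊢ <;> tauto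
      have e : w = v * cs.simple x * cs.wordProd (CoxeterSystem.alternatingWord s t j) := by
        rw [hwv, CoxeterSystem.alternatingWord_succ', ← hxj, cs.wordProd_cons, mul_assoc]
      have h₁ := cs.length_mul_le (v * cs.simple x)
        (cs.wordProd (CoxeterSystem.alternatingWord s t j))
      have h₂ := cs.length_wordProd_le (CoxeterSystem.alternatingWord s t j)
      rw [CoxeterSystem.length_alternatingWord] at h₂
      rw [← e] at h₁
      omega
  have hkM : M s t ≠ 0 → k + 1 ≤ M s t := by
    intro h0
    have hred : cs.IsReduced (CoxeterSystem.alternatingWord s t k) := by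
      have h₁ := cs.length_mul_le v (cs.wordProd (CoxeterSystem.alternatingWord s t k))
      have h₂ := cs.length_wordProd_le (CoxeterSystem.alternatingWord s t k)
      rw [← hwv] at h₁
      unfold CoxeterSystem.IsReduced
      rw [CoxeterSystem.length_alternatingWord] at h₂ ⊢
      omega
    have hle : k ≤ M s t := by
      by_contra hlt
      exact cs.not_isReduced_alternatingWord s t h0 (not_le.1 hlt) hred
    -- If k were M s t, the braid relation would rewrite the word so as to end in s, making s a
    -- right descent of w.
    refine lt_of_le_of_ne hle fun hkM => hs ?_
    obtain ⟨j, rfl⟩ : ∃ j, k = j + 1 := ⟨k - 1, by omega⟩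
    have e : w * cs.simple s = v * cs.wordProd (CoxeterSystem.alternatingWord s t j) := by
      rw [hwv, cs.prod_alternatingWord_eq_prod_alternatingWord_sub s t (j + 1) (by omega),
        show M s t * 2 - (j + 1) = j + 1 by omega, CoxeterSystem.alternatingWord_succ,
        cs.wordProd_concat, mul_assoc, cs.simple_mul_simple_cancel_right]
    have h₁ := cs.length_mul_le v (cs.wordProd (CoxeterSystem.alternatingWord s t j))
    have h₂ := cs.length_wordProd_le (CoxeterSystem.alternatingWord s t j)
    rw [CoxeterSystem.length_alternatingWord] at h₂
    rw [← e] at h₁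
    unfold CoxeterSystem.IsRightDescent
    omega
  have hvs := ih (cs.length v) (by omega) v rfl s (hdesc s (.inl rfl))
  have hvt := ih (cs.length v) (by omega) v rfl t (hdesc t (.inr rfl))
  have hU₁ := h.chebyshevSeq_nonneg hst (n := k + 1) hkM
  have hU₀ := h.chebyshevSeq_nonneg hst (n := k) fun h0 => (Nat.le_succ k).trans (hkM h0)
  rw [hwv, map_mul, Units.val_mul, ← Matrix.mulVec_mulVec, h.rep_wordProd,
    prod_alternatingWord_mulVec h.symm h.diag]
  split_ifs
  · rw [Matrix.mulVec_add, Matrix.mulVec_smul, Matrix.mulVec_smul]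
    exact add_nonneg (smul_nonneg hU₁ hvs) (smul_nonneg hU₀ hvt)
  · rw [Matrix.mulVec_add, Matrix.mulVec_smul, Matrix.mulVec_smul]
    exact add_nonneg (smul_nonneg hU₁ hvt) (smul_nonneg hU₀ hvs)

theorem col_nonneg (h : M.IsGeometricForm B) {w : M.Group} {s : I}
    (hs : ¬M.toCoxeterSystem.IsRightDescent w s) (i : I) : 0 ≤ (h.rep w).1 i s := by
  simpa using h.col_nonneg_aux _ w rfl s hs i

/-- The element w·s does not have s as a right descent, and σ_s negates the root of s. -/
theorem col_nonpos (h : M.IsGeometricForm B) {w : M.Group} {s : I}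
    (hs : M.toCoxeterSystem.IsRightDescent w s) (i : I) : (h.rep w).1 i s ≤ 0 := by
  have h₁ := h.col_nonneg_aux _ (w * M.toCoxeterSystem.simple s) rfl s
    (M.toCoxeterSystem.isRightDescent_iff_not_isRightDescent_mul.1 hs) i
  have e : (reflection B h.diag s).1.mulVec (Pi.single s 1) = -Pi.single s 1 := by
    change (reflectionMatrix B s).mulVec _ = _
    rw [reflectionMatrix_mulVec, dotProduct_single_one, h.diag]
    module
  rw [map_mul, M.toCoxeterSystem_simple, h.rep_simple, Units.val_mul, ← Matrix.mulVec_mulVec, e,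
    Matrix.mulVec_neg] at h₁
  simpa using h₁

/-- An element of a Coxeter group mapping all simple roots to non-negative combinations of simple
roots is trivial. -/
theorem eq_one_of_nonneg (h : M.IsGeometricForm B) {w : M.Group}
    (hw : ∀ i j, 0 ≤ (h.rep w).1 i j) : w = 1 := by
  by_contra hne
  obtain ⟨s, hs⟩ := M.toCoxeterSystem.exists_rightDescent_of_ne_one hne
  -- The column at a right descent has both signs, hence vanishes, which is impossible in an
  -- invertible matrix.
  have h0 : ∀ i, (h.rep w).1 i s = 0 := fun i => le_antisymm (h.col_nonpos hs i) (hw i s)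
  have h₁ : ((h.rep w)⁻¹.1 * (h.rep w).1) s s = 0 := by
    simp [Matrix.mul_apply, h0]
  rw [← Units.val_mul, inv_mul_cancel] at h₁
  simp at h₁

theorem rep_injective (h : M.IsGeometricForm B) : Function.Injective h.rep := by
  rw [injective_iff_map_eq_one]
  intro w hw
  refine h.eq_one_of_nonneg fun i j => ?_
  rw [hw, Units.val_one, Matrix.one_apply]
  split_ifs <;> norm_num

theorem reflectionGroup_col (h : M.IsGeometricForm B) {g : Matrix.GeneralLinearGroup I ℝ}
    (hg : g ∈ reflectionGroup B h.diag) (j : I) : (∀ i, 0 ≤ g.1 i j) ∨ ∀ i, g.1 i j ≤ 0 := by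
  rw [← h.range_rep] at hg
  obtain ⟨w, rfl⟩ := hg
  by_cases hd : M.toCoxeterSystem.IsRightDescent w j
  · exact .inr (h.col_nonpos hd)
  · exact .inl (h.col_nonneg hd)

theorem reflectionGroup_eq_one (h : M.IsGeometricForm B) {g : Matrix.GeneralLinearGroup I ℝ}
    (hg : g ∈ reflectionGroup B h.diag) (hnn : ∀ i j, 0 ≤ g.1 i j) : g = 1 := by
  rw [← h.range_rep] at hg
  obtain ⟨w, rfl⟩ := hg
  rw [h.eq_one_of_nonneg hnn, map_one]

end CoxeterMatrix.IsGeometricForm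

/-! ### Positive matrices -/

section PerronFrobenius

variable {n : Type*} [Fintype n] {A : Matrix n n ℝ}

theorem mulVec_pos_of_pos (hA : ∀ i j, 0 < A i j) {x : n → ℝ} (hx : ∀ i, 0 ≤ x i) (hx0 : x ≠ 0)
    (i : n) : 0 < A.mulVec x i := by
  obtain ⟨j, hj⟩ := Function.ne_iff.1 hx0
  exact Finset.sum_pos' (fun j _ => mul_nonneg (hA i j).le (hx j))
    ⟨j, Finset.mem_univ j, mul_pos (hA i j) (lt_of_le_of_ne (hx j) (Ne.symm hj))⟩

/-- The Collatz–Wielandt argument: a matrix with positive entries has a positive eigenvector. -/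
theorem exists_pos_eigenvector [Nonempty n] (hA : ∀ i j, 0 < A i j) :
    ∃ (v : n → ℝ) (r : ℝ), (∀ i, 0 < v i) ∧ A.mulVec v = r • v := by
  classical
  set C : ℝ := ∑ i, ∑ j, A i j
  have hbound : ∀ (r : ℝ) (x : n → ℝ), x ∈ stdSimplex ℝ n → (∀ i, r * x i ≤ A.mulVec x i) →
      r ≤ C := by
    intro r x hx h
    calc r = ∑ i, r * x i := by rw [← Finset.mul_sum, hx.2, mul_one]
      _ ≤ ∑ i, A.mulVec x i := Finset.sum_le_sum fun i _ => h i
      _ ≤ C := Finset.sum_le_sum fun i _ => Finset.sum_le_sum fun j _ =>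
        mul_le_of_le_one_right (hA i j).le
          (hx.2 ▸ Finset.single_le_sum (fun j _ => hx.1 j) (Finset.mem_univ j))
  -- Maximise r over the pairs with rx ≤ Ax on the simplex; the bound r ≤ C makes the set compact.
  set K : Set (ℝ × (n → ℝ)) :=
    (Set.Icc 0 C ×ˢ stdSimplex ℝ n) ∩ {p | ∀ i, p.1 * p.2 i ≤ A.mulVec p.2 i} with hK
  have hKc : IsCompact K := by
    refine (isCompact_Icc.prod (isCompact_stdSimplex ℝ n)).inter_right ?_
    rw [Set.ofPred_forall]
    refine isClosed_iInter fun i => isClosed_le (by fun_prop) ?_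
    simp only [Matrix.mulVec, dotProduct]
    fun_prop
  have hKn : K.Nonempty := by
    have hx := single_mem_stdSimplex ℝ (Classical.arbitrary n)
    have h0 : ∀ i, (0 : ℝ) * (Pi.single (Classical.arbitrary n) 1 : n → ℝ) i ≤
        A.mulVec (Pi.single (Classical.arbitrary n) 1) i := by
      intro i
      rw [zero_mul, Matrix.mulVec_single_one]
      exact (hA _ _).le
    exact ⟨(0, _), ⟨⟨⟨le_rfl, hbound 0 _ hx h0⟩, hx⟩, h0⟩⟩
  obtain ⟨⟨r, x⟩, hp, hmax⟩ := hKc.exists_isMaxOn hKn continuous_fst.continuousOn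
  obtain ⟨⟨⟨hr0, -⟩, hx⟩, hrx⟩ := hp
  dsimp only at hr0 hx hrx
  have hx0 : x ≠ 0 := by
    rintro rfl
    simpa using hx.2
  set y := A.mulVec x with hy
  have hypos : ∀ i, 0 < y i := mulVec_pos_of_pos hA hx.1 hx0
  have hyx : y = r • x := by
    -- Otherwise Ax - rx is nonnegative and nonzero, so A makes it strictly positive, and the
    -- normalised Ax admits a larger r.
    by_contra hne
    have hz : ∀ i, 0 < A.mulVec (y - r • x) i :=
      mulVec_pos_of_pos hA (fun i => sub_nonneg.2 (hrx i)) (sub_ne_zero.2 hne)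
    obtain ⟨i₀, hi₀⟩ := Finite.exists_min fun i => A.mulVec (y - r • x) i / y i
    set ε := A.mulVec (y - r • x) i₀ / y i₀ with hε
    have hεpos : 0 < ε := div_pos (hz _) (hypos _)
    have hle : ∀ i, (r + ε) * y i ≤ A.mulVec y i := by
      intro i
      have := (le_div_iff₀ (hypos i)).1 (hi₀ i)
      rw [Matrix.mulVec_sub, Matrix.mulVec_smul, ← hy, Pi.sub_apply, Pi.smul_apply,
        smul_eq_mul] at this
      linarith
    set c := ∑ i, y i with hc
    have hcpos : 0 < c := Finset.sum_pos (fun i _ => hypos i) Finset.univ_nonempty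
    have hmem : c⁻¹ • y ∈ stdSimplex ℝ n := by
      refine ⟨fun i => (mul_pos (inv_pos.2 hcpos) (hypos i)).le, ?_⟩
      simp only [Pi.smul_apply, smul_eq_mul]
      rw [← Finset.mul_sum, inv_mul_cancel₀ hcpos.ne']
    have hle' : ∀ i, (r + ε) * (c⁻¹ • y) i ≤ A.mulVec (c⁻¹ • y) i := by
      intro i
      rw [Matrix.mulVec_smul, Pi.smul_apply, Pi.smul_apply, smul_eq_mul, smul_eq_mul]
      nlinarith [mul_le_mul_of_nonneg_left (hle i) (inv_pos.2 hcpos).le]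
    have : r + ε ≤ r := hmax (show (r + ε, c⁻¹ • y) ∈ K from
      ⟨⟨⟨by positivity, hbound _ _ hmem hle'⟩, hmem⟩, hle'⟩)
    linarith
  refine ⟨y, r, hypos, ?_⟩
  conv_lhs => rw [hyx]
  rw [Matrix.mulVec_smul]

/-- Subtract from y the largest multiple of v that leaves a nonnegative vector. The difference has a
zero coordinate, yet A would make it strictly positive if it were nonzero. -/
theorem eq_smul_of_pos_eigenvector [Nonempty n] (hA : ∀ i j, 0 < A i j) {v : n → ℝ} {r : ℝ}
    (hv : ∀ i, 0 < v i) (hAv : A.mulVec v = r • v) {y : n → ℝ} (hy : A.mulVec y = r • y) :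
    ∃ c : ℝ, y = c • v := by
  obtain ⟨i₀, hi₀⟩ := Finite.exists_min fun i => y i / v i
  set c := y i₀ / v i₀ with hc
  refine ⟨c, sub_eq_zero.1 ?_⟩
  by_contra hne
  have hnn : ∀ i, 0 ≤ (y - c • v) i := fun i =>
    sub_nonneg.2 ((le_div_iff₀ (hv i)).1 (hi₀ i))
  have hpos := mulVec_pos_of_pos hA hnn hne i₀
  rw [Matrix.mulVec_sub, Matrix.mulVec_smul, hAv, hy] at hpos
  have e : c * v i₀ = y i₀ := div_mul_cancel₀ _ (hv i₀).ne'
  simp only [Pi.sub_apply, Pi.smul_apply, smul_eq_mul] at hpos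
  have : r * y i₀ - c * (r * v i₀) = 0 := by rw [← e]; ring
  linarith

/-- A real eigenvalue of a non-negative matrix with a positive eigenvector is bounded by the
eigenvalue of the latter. -/
theorem abs_eigenvalue_le [Nonempty n] (hA : ∀ i j, 0 ≤ A i j) {v : n → ℝ} {d : ℝ}
    (hv : ∀ i, 0 < v i) (hAv : A.mulVec v = d • v) {x : n → ℝ} {r : ℝ} (hx0 : x ≠ 0)
    (hx : A.mulVec x = r • x) : |r| ≤ d := by
  obtain ⟨i, hi⟩ := Finite.exists_max fun i => |x i| / v i
  set t := |x i| / v i with ht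
  have hle : ∀ j, |x j| ≤ t * v j := fun j => (div_le_iff₀ (hv j)).1 (hi j)
  have e : t * v i = |x i| := div_mul_cancel₀ _ (hv i).ne'
  have hxi : 0 < |x i| := by
    obtain ⟨j, hj⟩ := Function.ne_iff.1 hx0
    have h₁ := hle j
    have h₂ : 0 < |x j| := abs_pos.2 hj
    rw [← e]
    exact mul_pos (pos_of_mul_pos_left (h₂.trans_le h₁) (hv j).le) (hv i)
  refine le_of_mul_le_mul_right ?_ hxi
  calc |r| * |x i| = |A.mulVec x i| := by rw [hx, Pi.smul_apply, smul_eq_mul, abs_mul]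
    _ ≤ ∑ j, |A i j * x j| := Finset.abs_sum_le_sum_abs _ _
    _ ≤ ∑ j, t * (A i j * v j) := Finset.sum_le_sum fun j _ => by
      rw [abs_mul, abs_of_nonneg (hA i j)]
      nlinarith [mul_le_mul_of_nonneg_left (hle j) (hA i j)]
    _ = t * A.mulVec v i := by rw [← Finset.mul_sum]; rfl
    _ = d * |x i| := by rw [hAv, Pi.smul_apply, smul_eq_mul, ← e]; ring

theorem frobeniusPerronEigenvalue_eq [DecidableEq n] [Nonempty n] (hA : ∀ i j, 0 ≤ A i j)
    {v : n → ℝ} {d : ℝ} (hv : ∀ i, 0 < v i) (hAv : A.mulVec v = d • v) :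
    frobeniusPerronEigenvalue A = d := by
  have hv0 : v ≠ 0 := fun h => (hv (Classical.arbitrary n)).ne' (by rw [h]; rfl)
  refine IsGreatest.csSup_eq ⟨⟨(abs_nonneg d).trans (abs_eigenvalue_le hA hv hAv hv0 hAv), ?_⟩, ?_⟩
  · exact Module.End.hasEigenvalue_of_hasEigenvector
      (Module.End.hasEigenvector_iff.2 ⟨Module.End.mem_eigenspace_iff.2 hAv, hv0⟩)
  · rintro r ⟨-, hr⟩
    obtain ⟨x, hx⟩ := hr.exists_hasEigenvector
    exact (le_abs_self r).trans (abs_eigenvalue_le hA hv hAv hx.2 hx.apply_eq_smul)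

end PerronFrobenius

/-! ### Functions additive on split short complexes -/

section SplitAdditive

open Limits ZeroObject

attribute [local instance] Abelian.hasFiniteBiproducts

variable {C : Type u} [Category.{v} C] [Abelian C] {A : Type*} [AddCommGroup A]

/-- A function on objects is *split additive* if it is additive on split short complexes. -/
def SplitAdditive (f : C → A) : Prop :=
  ∀ S : ShortComplex C, S.Splitting → f S.X₂ = f S.X₁ + f S.X₃

theorem SplitAdditive.map_isZero {f : C → A} (hf : SplitAdditive f) {X : C} (hX : IsZero X) :
    f X = 0 := by
  have := hf (ShortComplex.mk (0 : X ⟶ X) (0 : X ⟶ X) (by simp))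
    { r := 0, s := 0, f_r := hX.eq_of_src _ _, s_g := hX.eq_of_src _ _, id := hX.eq_of_src _ _ }
  simpa using this

/-- An isomorphism gives the split complex X ⟶ Y ⟶ 0. -/
theorem SplitAdditive.map_iso {f : C → A} (hf : SplitAdditive f) {X Y : C} (e : X ≅ Y) :
    f X = f Y := by
  have := hf (ShortComplex.mk e.hom (0 : Y ⟶ 0) (by simp))
    { r := e.inv, s := 0, f_r := by simp, s_g := (isZero_zero C).eq_of_src _ _, id := by simp }
  simpa [hf.map_isZero (isZero_zero C)] using this.symm

theorem SplitAdditive.map_biproduct {f : C → A} (hf : SplitAdditive f) {n : ℕ} (S : Fin n → C) :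
    f (⨁ S) = ∑ i, f (S i) := by
  induction n with
  | zero =>
    rw [Finset.univ_eq_empty, Finset.sum_empty]
    refine hf.map_isZero ((IsZero.iff_id_eq_zero _).2 (biproduct.hom_ext _ _ fun i => i.elim0))
  | succ n ih =>
    have h := hf (ShortComplex.mk (biproduct.ι S 0)
      (biproduct.lift fun i : Fin n => biproduct.π S i.succ)
      (biproduct.hom_ext _ _ fun i => by
        simp [biproduct.ι_π_ne S (Fin.succ_ne_zero i).symm]))
      { r := biproduct.π S 0
        s := biproduct.desc fun i : Fin n => biproduct.ι S i.succ
        f_r := by simp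
        s_g := by
          refine biproduct.hom_ext _ _ fun i => biproduct.hom_ext' _ _ fun j => ?_
          by_cases hij : j = i
          · subst hij; simp
          · simp [biproduct.ι_π_ne _ hij,
              biproduct.ι_π_ne S fun h => hij (Fin.succ_injective _ h)]
        id := by
          refine biproduct.hom_ext' _ _ fun j => ?_
          refine Fin.cases ?_ (fun j => ?_) j
          · have : biproduct.ι S 0 ≫ (biproduct.lift fun i : Fin n => biproduct.π S i.succ) = 0 :=
              biproduct.hom_ext _ _ fun i => by
                simp [biproduct.ι_π_ne S (Fin.succ_ne_zero i).symm]
            simp [reassoc_of% this]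
          · have : biproduct.ι S j.succ ≫
                (biproduct.lift fun i : Fin n => biproduct.π S i.succ) =
                biproduct.ι (fun i : Fin n => S i.succ) j :=
              biproduct.hom_ext _ _ fun i => by
                by_cases hij : j = i
                · subst hij; simp
                · simp [biproduct.ι_π_ne _ hij,
                    biproduct.ι_π_ne S fun h => hij (Fin.succ_injective _ h)]
            simp [reassoc_of% this, biproduct.ι_π_ne_assoc S (Fin.succ_ne_zero j)] }
    dsimp only at h
    rw [h, ih, Fin.sum_univ_succ]

variable (k : Type w) [Field k] [Linear k C]

theorem splitAdditive_finrank_hom_from [∀ X Y : C, FiniteDimensional k (X ⟶ Y)] (T : C) :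
    SplitAdditive fun X : C => (Module.finrank k (T ⟶ X) : ℤ) := by
  intro S s
  let e : (T ⟶ S.X₂) ≃ₗ[k] (T ⟶ S.X₁) × (T ⟶ S.X₃) :=
    { toFun f := (f ≫ s.r, f ≫ S.g)
      map_add' f g := by simp
      map_smul' c f := by simp
      invFun p := p.1 ≫ S.f + p.2 ≫ s.s
      left_inv f := by
        simp only [Category.assoc]
        rw [← Preadditive.comp_add, s.id, Category.comp_id]
      right_inv p := by simp }
  dsimp only
  rw [e.finrank_eq, Module.finrank_prod, Nat.cast_add]

theorem splitAdditive_finrank_hom_to [∀ X Y : C, FiniteDimensional k (X ⟶ Y)] (T : C) :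
    SplitAdditive fun X : C => (Module.finrank k (X ⟶ T) : ℤ) := by
  intro S s
  let e : (S.X₂ ⟶ T) ≃ₗ[k] (S.X₁ ⟶ T) × (S.X₃ ⟶ T) :=
    { toFun f := (S.f ≫ f, s.s ≫ f)
      map_add' f g := by simp
      map_smul' c f := by simp
      invFun p := s.r ≫ p.1 + S.g ≫ p.2
      left_inv f := by
        simp only [← Category.assoc]
        rw [← Preadditive.add_comp, s.id, Category.id_comp]
      right_inv p := by simp }
  dsimp only
  rw [e.finrank_eq, Module.finrank_prod, Nat.cast_add]

end SplitAdditive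

/-! ### Semisimplicity -/

namespace FusionCategory

open Limits

attribute [local instance] Abelian.hasFiniteBiproducts

variable (k : Type w) [Field k] {C : Type u} [Category.{v} C] [Abelian C] [Linear k C]
  [MonoidalCategory C] [MonoidalPreadditive C] [MonoidalLinear k C] [RigidCategory C]
  [FusionCategory k C]

include k

/-- Pull the epimorphism back along f. Some simple summand of the pullback maps nontrivially to S,
hence isomorphically by Schur, and this provides the lift. -/
theorem projective_of_simple (S : C) [Simple S] : Projective S where
  factors {E X} f e _ := by
    obtain ⟨n, T, hT, ⟨φ⟩⟩ := semisimple k (pullback f e)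
    obtain ⟨a, ha⟩ : ∃ a, biproduct.ι T a ≫ φ.inv ≫ pullback.fst f e ≠ 0 := by
      by_contra! h
      have h0 : φ.inv ≫ pullback.fst f e = 0 := biproduct.hom_ext' _ _ fun a => by simpa using h a
      have h1 : pullback.fst f e = 0 := by rw [← cancel_epi φ.inv, h0, comp_zero]
      have h2 : 𝟙 S = 0 := by rw [← cancel_epi (pullback.fst f e), h1, zero_comp, zero_comp]
      exact id_nonzero S h2
    have := hT a
    rw [← Category.assoc] at ha
    generalize biproduct.ι T a ≫ φ.inv = u at ha
    have : IsIso (u ≫ pullback.fst f e) := isIso_of_hom_simple ha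
    refine ⟨inv (u ≫ pullback.fst f e) ≫ u ≫ pullback.snd f e, ?_⟩
    have h : (u ≫ pullback.snd f e) ≫ e = (u ≫ pullback.fst f e) ≫ f := by
      rw [Category.assoc, Category.assoc, pullback.condition]
    rw [Category.assoc, h, IsIso.inv_hom_id_assoc]

theorem projective (X : C) : Projective X := by
  obtain ⟨n, T, hT, ⟨φ⟩⟩ := semisimple k X
  have : ∀ a, Projective (T a) := fun a => have := hT a; projective_of_simple k (T a)
  have : Projective (⨁ T) :=
    { factors f e _ :=
        ⟨biproduct.desc fun a => Projective.factorThru (biproduct.ι T a ≫ f) e, by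
          refine biproduct.hom_ext' _ _ fun a => ?_
          simp⟩ }
  exact Projective.of_iso φ.symm this

/-- Semisimplicity splits every short exact sequence, so split additive functions descend to the
Grothendieck group. -/
theorem map_of_shortExact {A : Type*} [AddCommGroup A] {f : C → A} (hf : SplitAdditive f)
    {S : ShortComplex C} (hS : S.ShortExact) : f S.X₂ = f S.X₁ + f S.X₃ :=
  have := projective k S.X₃
  hf S hS.splittingOfProjective


/-- Both sides are additive in X, and for simple X both are 0 or 1 by Schur's lemma over an
algebraically closed field. -/
theorem finrank_hom_comm [IsAlgClosed k] (X S : C) [Simple S] :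
    Module.finrank k (X ⟶ S) = Module.finrank k (S ⟶ X) := by
  have := finite_hom (k := k) (C := C)
  obtain ⟨n, T, hT, ⟨φ⟩⟩ := semisimple k X
  have h₁ := splitAdditive_finrank_hom_to k S
  have h₂ := splitAdditive_finrank_hom_from k S
  zify
  have e₁ := (h₁.map_iso φ).trans (h₁.map_biproduct T)
  have e₂ := (h₂.map_iso φ).trans (h₂.map_biproduct T)
  rw [e₁, e₂]
  refine Finset.sum_congr rfl fun a _ => ?_
  have := hT a
  rw [finrank_hom_simple_simple, finrank_hom_simple_simple]
  congr 2
  exact propext ⟨fun ⟨e⟩ => ⟨e.symm⟩, fun ⟨e⟩ => ⟨e.symm⟩⟩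

omit k

end FusionCategory

/-! ### The Grothendieck ring of a fusion category -/

namespace GrothendieckRing

open Limits

attribute [local instance] Abelian.hasFiniteBiproducts

section

variable {C : Type u} [Category.{v} C] [Abelian C] [MonoidalCategory C] [MonoidalPreadditive C]
  [RigidCategory C]

theorem splitAdditive_cls : SplitAdditive (cls : C → GrothendieckRing C) := by
  intro S s
  rw [← sub_eq_zero, ← sub_sub]
  exact Ideal.Quotient.eq_zero_iff_mem.2 (AddSubgroup.subset_closure ⟨S, s.shortExact, rfl⟩)

theorem cls_mul_cls (X Y : C) : cls X * cls Y = cls (X ⊗ Y) := by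
  rw [cls, cls, ← map_mul, FreeAbelianGroup.of_mul_of, ← Skeleton.toSkeleton_tensorObj]
  rfl

theorem induction {p : GrothendieckRing C → Prop} (zero : p 0) (cls : ∀ X : C, p (cls X))
    (neg : ∀ X : C, p (-GrothendieckRing.cls X)) (add : ∀ x y, p x → p y → p (x + y))
    (x : GrothendieckRing C) : p x := by
  obtain ⟨a, rfl⟩ := Ideal.Quotient.mk_surjective x
  induction a using FreeAbelianGroup.induction_on with
  | zero => simpa using zero
  | of x =>
    obtain ⟨X, rfl⟩ : ∃ X : C, toSkeleton X = x := ⟨x.out, Quotient.out_eq x⟩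
    exact cls X
  | neg x _ =>
    obtain ⟨X, rfl⟩ : ∃ X : C, toSkeleton X = x := ⟨x.out, Quotient.out_eq x⟩
    rw [map_neg]
    exact neg X
  | add x y hx hy =>
    rw [map_add]
    exact add _ _ hx hy

theorem addHom_ext {A : Type*} [AddCommGroup A] {f g : GrothendieckRing C →+ A}
    (h : ∀ X : C, f (cls X) = g (cls X)) : f = g :=
  AddMonoidHom.ext fun x => induction (p := fun x => f x = g x) (by simp) h (fun X => by simp [h])
    (fun x y hx hy => by simp [hx, hy]) x

end

variable (k : Type w) [Field k] {C : Type u} [Category.{v} C] [Abelian C] [Linear k C]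
  [MonoidalCategory C] [MonoidalPreadditive C] [MonoidalLinear k C] [RigidCategory C]
  [FusionCategory k C]

/-- The additive map on the Grothendieck ring induced by a split additive function. -/
def lift {A : Type*} [AddCommGroup A] (f : C → A) (hf : SplitAdditive f) :
    GrothendieckRing C →+ A :=
  QuotientAddGroup.lift (exactIdeal C).toAddSubgroup
    (FreeAbelianGroup.lift fun x : Skeleton C => f x.out) (by
      intro z hz
      have hz' : z ∈ exactRelations C := hz
      have hcls : ∀ X : C, f (toSkeleton X).out = f X := fun X =>
        hf.map_iso (fromSkeletonToSkeletonIso X)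
      refine AddSubgroup.closure_induction (fun z hz => ?_) (zero_mem _)
        (fun x y _ _ hx hy => add_mem hx hy) (fun x _ hx => neg_mem hx) hz'
      obtain ⟨S, hS, rfl⟩ := hz
      simp [AddMonoidHom.mem_ker, hcls, FusionCategory.map_of_shortExact k hf hS])

theorem lift_cls {A : Type*} [AddCommGroup A] (f : C → A) (hf : SplitAdditive f) (X : C) :
    lift k f hf (cls X) = f X := by
  have : lift k f hf (cls X) = FreeAbelianGroup.lift (fun x : Skeleton C => f x.out)
    (FreeAbelianGroup.of (toSkeleton X)) := rfl
  rw [this, FreeAbelianGroup.lift_apply_of]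
  exact hf.map_iso (fromSkeletonToSkeletonIso X)

/-- The coordinate of an element of the Grothendieck ring at a simple object. -/
def coord (i : IrrObj C) : GrothendieckRing C →+ ℤ :=
  lift k (fun X => (Module.finrank k (i.1.out ⟶ X) : ℤ))
    (have := FusionCategory.finite_hom (k := k) (C := C); splitAdditive_finrank_hom_from k _)

theorem coord_cls (i : IrrObj C) (X : C) :
    coord k i (cls X) = Module.finrank k (i.1.out ⟶ X) :=
  lift_cls k _ _ X

include k in
theorem exists_cls_eq_sum (X : C) : ∃ (n : ℕ) (a : Fin n → IrrObj C),
    cls X = ∑ j, cls (a j).1.out := by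
  obtain ⟨n, S, hS, ⟨φ⟩⟩ := FusionCategory.semisimple k X
  let ψ (j : Fin n) : (toSkeleton (S j)).out ≅ S j := fromSkeletonToSkeletonIso (S j)
  refine ⟨n, fun j => ⟨toSkeleton (S j), have := hS j; Simple.of_iso (ψ j)⟩, ?_⟩
  rw [splitAdditive_cls.map_iso φ, splitAdditive_cls.map_biproduct]
  exact Finset.sum_congr rfl fun j _ => (splitAdditive_cls.map_iso (ψ j)).symm

variable [IsAlgClosed k]

theorem coord_irr [DecidableEq (IrrObj C)] (i j : IrrObj C) :
    coord k i (cls j.1.out) = if i = j then 1 else 0 := by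
  have := FusionCategory.finite_hom (k := k) (C := C)
  have := i.2
  have := j.2
  rw [coord_cls, finrank_hom_simple_simple]
  have : Nonempty (i.1.out ≅ j.1.out) ↔ i = j := by
    constructor
    · rintro ⟨e⟩
      refine Subtype.ext ?_
      rw [← Quotient.out_eq i.1, ← Quotient.out_eq j.1]
      exact Quotient.sound ⟨e⟩
    · rintro rfl
      exact ⟨Iso.refl _⟩
  simp [this]

variable [Fintype (IrrObj C)]

theorem eq_sum_coord (x : GrothendieckRing C) : x = ∑ i, coord k i x • cls i.1.out := by
  classical
  let F : GrothendieckRing C →+ GrothendieckRing C :=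
    ∑ i, ((zmultiplesHom (GrothendieckRing C)) (cls i.1.out)).comp (coord k i)
  have hF : ∀ x, F x = ∑ i, coord k i x • cls i.1.out := fun x => by simp [F]
  rw [← hF]
  refine (DFunLike.congr_fun (addHom_ext (f := F) (g := AddMonoidHom.id _) fun X => ?_) x).symm
  obtain ⟨n, a, h⟩ := exists_cls_eq_sum k X
  rw [h, map_sum, map_sum]
  refine Finset.sum_congr rfl fun j _ => ?_
  rw [hF]
  simp [coord_irr]

variable [DecidableEq (IrrObj C)]

/-- The matrix of left multiplication in the basis of simple objects. -/
def leftMatrix : GrothendieckRing C →+* Matrix (IrrObj C) (IrrObj C) ℝ where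
  toFun x := Matrix.of fun i j => (coord k i (x * cls j.1.out) : ℝ)
  map_one' := by
    ext i j
    simp [coord_irr, Matrix.one_apply]
  map_zero' := by
    ext i j
    simp
  map_add' x y := by
    ext i j
    simp [add_mul]
  map_mul' x y := by
    ext i j
    rw [Matrix.mul_apply, Matrix.of_apply, mul_assoc]
    -- Expanding y[S_j] in simple classes produces the matrix product.
    conv_lhs => rw [eq_sum_coord k (y * cls j.1.out)]
    simp [Finset.mul_sum, -zsmul_eq_mul, mul_comm]

theorem leftMatrix_apply (x : GrothendieckRing C) (i j : IrrObj C) :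
    leftMatrix k x i j = coord k i (x * cls j.1.out) := rfl

theorem leftMatrix_cls (X : C) : leftMatrix k (cls X) = fusionMatrix k X := by
  ext i j
  rw [leftMatrix_apply, cls_mul_cls, coord_cls]
  simp [fusionMatrix]

theorem leftMatrix_cls_nonneg (X : C) (i j : IrrObj C) : 0 ≤ leftMatrix k (cls X) i j := by
  rw [leftMatrix_cls]
  simp [fusionMatrix]

theorem leftMatrix_injective : Function.Injective (leftMatrix k (C := C)) := by
  rw [injective_iff_map_eq_zero]
  intro x hx
  have h : ∀ i j : IrrObj C, coord k i (x * cls j.1.out) = 0 := fun i j => by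
    have := congrFun (congrFun hx i) j
    rw [leftMatrix_apply, Matrix.zero_apply] at this
    exact_mod_cast this
  have h' : ∀ i, coord k i x = 0 := fun i => by
    rw [← mul_one x, eq_sum_coord k (1 : GrothendieckRing C)]
    simp [Finset.mul_sum, -zsmul_eq_mul, h]
  rw [eq_sum_coord k x]
  simp [h']

/-- The matrix of right multiplication in the basis of simple objects. -/
def rightMatrix (y : GrothendieckRing C) : Matrix (IrrObj C) (IrrObj C) ℝ :=
  Matrix.of fun i j => (coord k i (cls j.1.out * y) : ℝ)

/-- This is associativity: left and right multiplications commute. -/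
theorem leftMatrix_mul_rightMatrix (x y : GrothendieckRing C) :
    leftMatrix k x * rightMatrix k y = rightMatrix k y * leftMatrix k x := by
  ext i j
  have h₁ : (leftMatrix k x * rightMatrix k y) i j = coord k i (x * (cls j.1.out * y)) := by
    conv_rhs => rw [eq_sum_coord k (cls j.1.out * y)]
    simp [Matrix.mul_apply, leftMatrix_apply, rightMatrix, Finset.mul_sum, -zsmul_eq_mul, mul_comm]
  have h₂ : (rightMatrix k y * leftMatrix k x) i j = coord k i (x * cls j.1.out * y) := by
    conv_rhs => rw [eq_sum_coord k (x * cls j.1.out)]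
    simp [Matrix.mul_apply, leftMatrix_apply, rightMatrix, Finset.sum_mul, -zsmul_eq_mul, mul_comm]
  rw [h₁, h₂, mul_assoc]

/-- Duality identifies Hom(X ⊗ S_i, S_j) with Hom(S_i, ᘁX ⊗ S_j), and the dimension of the former
counts S_j in X ⊗ S_i. -/
theorem leftMatrix_leftDual (X : C) :
    leftMatrix k (cls (ᘁX)) = (leftMatrix k (cls X)).transpose := by
  ext i j
  rw [leftMatrix_cls, leftMatrix_cls, Matrix.transpose_apply]
  have := i.2
  have := j.2
  let e : (X ⊗ i.1.out ⟶ j.1.out) ≃ₗ[k] (i.1.out ⟶ (ᘁX) ⊗ j.1.out) :=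
    { tensorLeftHomEquiv i.1.out (ᘁX) X j.1.out with
      map_add' f g := by simp [tensorLeftHomEquiv]
      map_smul' c f := by simp [tensorLeftHomEquiv] }
  simp only [fusionMatrix, Matrix.of_apply]
  rw [← e.finrank_eq, FusionCategory.finrank_hom_comm]

end GrothendieckRing

/-! ### Nonvanishing of tensor products and positivity of right multiplication -/

namespace FusionCategory

open Limits

variable (k : Type w) [Field k] {C : Type u} [Category.{v} C] [Abelian C] [Linear k C]
  [MonoidalCategory C] [MonoidalPreadditive C] [MonoidalLinear k C] [RigidCategory C]
  [FusionCategory k C]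

include k

/-- The coevaluation of X is nonzero by the zigzag identity, hence mono because the unit is simple.
Tensoring it with Y embeds Y in X ⊗ Xᘁ ⊗ Y. -/
theorem isZero_of_isZero_rightDual_tensor {X Y : C} (hX : ¬IsZero X) (h : IsZero (Xᘁ ⊗ Y)) :
    IsZero Y := by
  have := simple_unit (k := k) (C := C)
  have hη : η_ X (Xᘁ) ≠ 0 := by
    intro h0
    have := ExactPairing.evaluation_coevaluation X (Xᘁ)
    rw [h0, MonoidalPreadditive.zero_whiskerRight, zero_comp] at this
    refine hX ((IsZero.iff_id_eq_zero X).2 ?_)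
    rw [← cancel_epi (λ_ X).hom, ← cancel_mono (ρ_ X).inv, Category.comp_id, ← this]
    simp
  have : Mono (η_ X (Xᘁ)) := mono_of_nonzero_from_simple hη
  have : (tensorRight Y).IsRightAdjoint :=
    (tensorRightAdjunction (HasLeftDual.leftDual Y) Y).isRightAdjoint
  have : Mono (η_ X (Xᘁ) ▷ Y) := inferInstanceAs (Mono ((tensorRight Y).map (η_ X (Xᘁ))))
  have hz : IsZero ((X ⊗ Xᘁ) ⊗ Y) :=
    ((tensorLeft X).map_isZero h).of_iso (α_ _ _ _)
  exact (IsZero.of_mono (η_ X (Xᘁ) ▷ Y) hz).of_iso (λ_ Y).symm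

theorem nontrivial_hom_tensor {X Y : C} (hX : ¬IsZero X) (hY : ¬IsZero Y) :
    Nontrivial (Y ⟶ X ⊗ (Xᘁ ⊗ Y)) := by
  have : Nontrivial (Xᘁ ⊗ Y ⟶ Xᘁ ⊗ Y) :=
    ⟨𝟙 _, 0, fun h => hY (isZero_of_isZero_rightDual_tensor k hX ((IsZero.iff_id_eq_zero _).2 h))⟩
  exact (tensorLeftHomEquiv Y X (Xᘁ) (Xᘁ ⊗ Y)).symm.nontrivial

end FusionCategory

namespace GrothendieckRing

variable (k : Type w) [Field k] [IsAlgClosed k] {C : Type u} [Category.{v} C] [Abelian C]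
  [Linear k C] [MonoidalCategory C] [MonoidalPreadditive C] [MonoidalLinear k C] [RigidCategory C]
  [FusionCategory k C] [Fintype (IrrObj C)]

/-- S_i occurs in S_j ⊗ (S_jᘁ ⊗ S_i), so it occurs in S_j ⊗ S_l for some simple S_l. -/
theorem rightMatrix_pos (i j : IrrObj C) :
    0 < rightMatrix k (∑ l : IrrObj C, cls l.1.out) i j := by
  have := FusionCategory.finite_hom (k := k) (C := C)
  have := i.2
  have := j.2
  have hnn : ∀ l : IrrObj C, 0 ≤ coord k i (cls j.1.out * cls l.1.out) := fun l => by
    rw [cls_mul_cls, coord_cls]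
    positivity
  rw [rightMatrix, Matrix.of_apply, Finset.mul_sum, map_sum]
  norm_cast
  refine Finset.sum_pos' (fun l _ => hnn l) ?_
  by_contra! h
  have h0 : ∀ l : IrrObj C, coord k i (cls j.1.out * cls l.1.out) = 0 := fun l =>
    le_antisymm (h l (Finset.mem_univ l)) (hnn l)
  have := FusionCategory.nontrivial_hom_tensor k (Simple.not_isZero j.1.out)
    (Simple.not_isZero i.1.out)
  have hpos : (0 : ℤ) < coord k i (cls j.1.out * cls ((j.1.out)ᘁ ⊗ i.1.out)) := by
    rw [cls_mul_cls, coord_cls]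
    exact_mod_cast Module.finrank_pos
  rw [eq_sum_coord k (cls ((j.1.out)ᘁ ⊗ i.1.out))] at hpos
  simp [Finset.mul_sum, -zsmul_eq_mul, h0] at hpos

end GrothendieckRing

/-! ### The Frobenius–Perron character -/

namespace GrothendieckRing

variable (k : Type w) [Field k] {C : Type u} [Category.{v} C] [Abelian C] [Linear k C]
  [MonoidalCategory C] [MonoidalPreadditive C] [MonoidalLinear k C] [RigidCategory C]
  [FusionCategory k C]

include k in
theorem nonempty_irrObj : Nonempty (IrrObj C) :=
  have := FusionCategory.simple_unit (k := k) (C := C)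
  ⟨⟨toSkeleton (𝟙_ C), Simple.of_iso (fromSkeletonToSkeletonIso (𝟙_ C))⟩⟩

variable [IsAlgClosed k] [Fintype (IrrObj C)] [DecidableEq (IrrObj C)]

variable (C) in
/-- There is a character of the Grothendieck ring with a common positive eigenvector for all left
multiplications. -/
theorem exists_character : ∃ (fp : GrothendieckRing C →+* ℝ) (d : IrrObj C → ℝ),
    (∀ i, 0 < d i) ∧ ∀ x, (leftMatrix k x).mulVec d = fp x • d := by
  have := nonempty_irrObj k (C := C)
  have hR := rightMatrix_pos k (C := C)
  obtain ⟨d, r, hd, hdr⟩ := exists_pos_eigenvector hR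
  -- Left multiplications commute with the positive right multiplication, so they preserve its
  -- Perron eigenspace, which is a line.
  have hex : ∀ x, ∃ c : ℝ, (leftMatrix k x).mulVec d = c • d := fun x => by
    refine eq_smul_of_pos_eigenvector hR hd hdr ?_
    rw [Matrix.mulVec_mulVec, ← leftMatrix_mul_rightMatrix, ← Matrix.mulVec_mulVec, hdr,
      Matrix.mulVec_smul]
  choose c hc using hex
  have hinj : ∀ {a b : ℝ}, a • d = b • d → a = b := fun {a b} h =>
    mul_right_cancel₀ (hd (Classical.arbitrary _)).ne' (congrFun h (Classical.arbitrary _))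
  refine ⟨{ toFun := c, map_one' := ?_, map_mul' := ?_, map_zero' := ?_, map_add' := ?_ }, d, hd, hc⟩
  · exact hinj (by rw [← hc, map_one, Matrix.one_mulVec, one_smul])
  · intro x y
    refine hinj ?_
    rw [← hc, map_mul, ← Matrix.mulVec_mulVec, hc, Matrix.mulVec_smul, hc, smul_smul, mul_comm]
  · exact hinj (by rw [← hc, map_zero, Matrix.zero_mulVec, zero_smul])
  · intro x y
    exact hinj (by rw [← hc, map_add, Matrix.add_mulVec, hc, hc, add_smul])

variable {k} {fp : GrothendieckRing C →+* ℝ} {d : IrrObj C → ℝ}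

theorem character_cls (hd : ∀ i, 0 < d i) (h : ∀ x, (leftMatrix k x).mulVec d = fp x • d) (X : C) :
    fp (cls X) = FPdim k X := by
  have := nonempty_irrObj k (C := C)
  have e : FPdim k X = frobeniusPerronEigenvalue (fusionMatrix k X) := by
    unfold FPdim
    congr!
  rw [e, frobeniusPerronEigenvalue_eq _ hd (by rw [← leftMatrix_cls]; exact h (cls X))]
  intro i j
  simp [fusionMatrix]

/-- Compare ⟨Ld, d⟩ with ⟨Lᵀd, d⟩, where L is the matrix of X. -/
theorem character_leftDual (hd : ∀ i, 0 < d i) (h : ∀ x, (leftMatrix k x).mulVec d = fp x • d)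
    (X : C) : fp (cls (ᘁX)) = fp (cls X) := by
  have := nonempty_irrObj k (C := C)
  have hdd : 0 < d ⬝ᵥ d :=
    Finset.sum_pos (fun i _ => mul_pos (hd i) (hd i)) Finset.univ_nonempty
  refine mul_right_cancel₀ hdd.ne' ?_
  rw [← smul_eq_mul, ← smul_eq_mul, ← dotProduct_smul, ← smul_dotProduct, ← h, ← h,
    leftMatrix_leftDual, dotProduct_comm, Matrix.mulVec_transpose, ← Matrix.dotProduct_mulVec,
    dotProduct_comm]

theorem vecMul_character (hd : ∀ i, 0 < d i) (h : ∀ x, (leftMatrix k x).mulVec d = fp x • d)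
    (x : GrothendieckRing C) : Matrix.vecMul d (leftMatrix k x) = fp x • d := by
  refine induction (p := fun x => Matrix.vecMul d (leftMatrix k x) = fp x • d) ?_ ?_ ?_ ?_ x
  · simp
  · intro X
    rw [← Matrix.mulVec_transpose, ← leftMatrix_leftDual, h, character_leftDual hd h]
  · intro X
    rw [map_neg, Matrix.vecMul_neg, ← Matrix.mulVec_transpose, ← leftMatrix_leftDual, h,
      character_leftDual hd h, map_neg, neg_smul]
  · intro x y hx hy
    rw [map_add, Matrix.vecMul_add, hx, hy, map_add, add_smul]

end GrothendieckRing

/-! ### Integral forms and commuting reflections -/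

section IntegralForm

variable {I : Type*} [DecidableEq I]

/-- The Coxeter matrix with label `2`, `3`, `∞` at `i ≠ j` if the entry of `B` is `0`, `-1`, or
anything else, respectively. -/
def integralCoxeterMatrix (B : Matrix I I ℝ) (hB : B.IsSymm) : CoxeterMatrix I where
  M := Matrix.of fun i j =>
    open Classical in if i = j then 1 else if B i j = 0 then 2 else if B i j = -1 then 3 else 0
  isSymm := by
    ext i j
    simp only [Matrix.transpose_apply, Matrix.of_apply, hB.apply i j, eq_comm]
  diagonal i := by simp
  off_diagonal i j h := by
    simp only [Matrix.of_apply, if_neg h]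
    split_ifs <;> simp

theorem isGeometricForm_integralCoxeterMatrix {B : Matrix I I ℝ} (hB : B.IsSymm)
    (h : ∀ i, B i i = 2) (hn : ∀ i j, i ≠ j → ∃ n : ℕ, B i j = -n) :
    (integralCoxeterMatrix B hB).IsGeometricForm B where
  symm := hB
  diag := h
  finite i j hij h0 := by
    have e : integralCoxeterMatrix B hB i j =
      open Classical in if i = j then 1 else if B i j = 0 then 2 else if B i j = -1 then 3 else 0 :=
      rfl
    rw [e, if_neg hij] at h0 ⊢
    split_ifs at h0 ⊢ with h₁ h₂
    · rw [h₁]; simp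
    · rw [h₂]; norm_num [Real.cos_pi_div_three]
    · exact absurd rfl h0
  infinite i j h0 := by
    have e : integralCoxeterMatrix B hB i j =
      open Classical in if i = j then 1 else if B i j = 0 then 2 else if B i j = -1 then 3 else 0 :=
      rfl
    rw [e] at h0
    split_ifs at h0 with hij h₁ h₂
    obtain ⟨n, hn⟩ := hn i j hij
    rw [hn] at h₁ h₂ ⊢
    have : n ≠ 0 := by rintro rfl; simp at h₁
    have : n ≠ 1 := by rintro rfl; simp at h₂
    have : (2 : ℝ) ≤ n := by exact_mod_cast (show 2 ≤ n by omega)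
    linarith

/-- The product of the reflections at pairwise orthogonal simple roots. -/
theorem exists_mem_reflectionGroup_of_orthogonal [Fintype I] {B : Matrix I I ℝ}
    (h : ∀ i, B i i = 2) (S : Finset I) (hS : ∀ i ∈ S, ∀ j ∈ S, i ≠ j → B i j = 0) :
    ∃ g ∈ reflectionGroup B h, g.1 = 1 - Matrix.of fun i j => if i ∈ S then B i j else 0 := by
  induction S using Finset.induction_on with
  | empty =>
    refine ⟨1, one_mem _, ?_⟩
    ext i j
    simp
  | insert a S ha ih =>
    obtain ⟨g, hg, e⟩ := ih fun i hi j hj =>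
      hS i (Finset.mem_insert_of_mem hi) j (Finset.mem_insert_of_mem hj)
    refine ⟨reflection B h a * g, mul_mem (Subgroup.subset_closure ⟨a, rfl⟩) hg, ?_⟩
    rw [Units.val_mul, e]
    change reflectionMatrix B a * _ = _
    have h0 : (Matrix.of fun i j => if i = a then B a j else 0 : Matrix I I ℝ) *
        (Matrix.of fun i j => if i ∈ S then B i j else 0) = 0 := by
      ext i j
      rw [Matrix.mul_apply]
      refine Finset.sum_eq_zero fun l _ => ?_
      by_cases hl : l ∈ S
      · have : a ≠ l := by rintro rfl; exact ha hl
        simp [hS a (Finset.mem_insert_self a S) l (Finset.mem_insert_of_mem hl) this]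
      · simp [hl]
    rw [reflectionMatrix, sub_mul, mul_sub, mul_sub, h0, one_mul, one_mul, mul_one]
    ext i j
    by_cases hi : i = a
    · subst hi; simp [ha]
    · simp [hi]

theorem coe_list_prod_reflection [Fintype I] {R : Type*} [Ring R] {B : Matrix I I R}
    (h : ∀ i, B i i = 2) (ω : List I) :
    (ω.map (reflection B h)).prod.1 = (ω.map (reflectionMatrix B)).prod := by
  induction ω with
  | nil => rfl
  | cons i ω ih =>
    rw [List.map_cons, List.prod_cons, Units.val_mul, ih, List.map_cons, List.prod_cons]
    rfl

/-- If the columns of all elements of the reflection group are non-negative or non-positive, then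
every off-diagonal entry in `(-2, 0]` of the form is `-2 cos (π / m)` for an integer `m ≥ 2`. -/
theorem exists_eq_two_mul_cos [Fintype I] {B : Matrix I I ℝ} (hB : B.IsSymm) (h : ∀ i, B i i = 2)
    (hcol : ∀ g ∈ reflectionGroup B h, ∀ j, (∀ i, 0 ≤ g.1 i j) ∨ ∀ i, g.1 i j ≤ 0) {s t : I}
    (hst : s ≠ t) (h0 : 0 ≤ -B s t) (h2 : -B s t < 2) :
    ∃ m : ℕ, 2 ≤ m ∧ -B s t = 2 * Real.cos (Real.pi / m) := by
  set θ := Real.arccos (-B s t / 2) with hθ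
  have hcos : -B s t = 2 * Real.cos θ := by
    rw [hθ, Real.cos_arccos (by linarith) (by linarith)]; ring
  have hθ0 : 0 < θ := Real.arccos_pos.2 (by linarith)
  have hθ1 : θ ≤ Real.pi / 2 := Real.arccos_le_pi_div_two.2 (by linarith)
  have hpi := Real.pi_pos
  have hsin : 0 < Real.sin θ := Real.sin_pos_of_pos_of_lt_pi hθ0 (by linarith)
  have hex : ∃ k : ℕ, Real.pi ≤ k * θ := by
    obtain ⟨k, hk⟩ := exists_nat_ge (Real.pi / θ)
    exact ⟨k, (div_le_iff₀ hθ0).1 hk⟩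
  classical
  -- With k = j + 1 least such that kθ ≥ π, the column of the alternating word of length j has
  -- entries sin(jθ)/sin θ > 0 and sin(kθ)/sin θ. Equal signs give sin(kθ) ≥ 0, while π ≤ kθ < π +
  -- θ, so kθ = π.
  obtain ⟨k, hk, hmin⟩ : ∃ k : ℕ, Real.pi ≤ k * θ ∧ ∀ j < k, (j : ℝ) * θ < Real.pi :=
    ⟨Nat.find hex, Nat.find_spec hex, fun j hj => not_le.1 (Nat.find_min hex hj)⟩
  have hk2 : 2 ≤ k := by
    by_contra! hlt
    have : (k : ℝ) ≤ 1 := by exact_mod_cast (show k ≤ 1 by omega)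
    nlinarith
  obtain ⟨j, rfl⟩ : ∃ j, k = j + 1 := ⟨k - 1, by omega⟩
  have hj1 : (1 : ℝ) ≤ j := by exact_mod_cast (show 1 ≤ j by omega)
  have hj := hmin j (Nat.lt_succ_self j)
  have hkj : ((j + 1 : ℕ) : ℝ) * θ = j * θ + θ := by push_cast; ring
  have hUj : 0 < chebyshevSeq (-B s t) j := by
    rw [hcos, chebyshevSeq_eq_div hsin.ne']
    exact div_pos (Real.sin_pos_of_pos_of_lt_pi (by nlinarith) hj) hsin
  have hU : 0 ≤ chebyshevSeq (-B s t) (j + 1) := by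
    have hc := hcol ((CoxeterSystem.alternatingWord s t j).map (reflection B h)).prod
      (Subgroup.list_prod_mem _ fun x hx => by
        obtain ⟨i, -, rfl⟩ := List.mem_map.1 hx
        exact Subgroup.subset_closure ⟨i, rfl⟩) s
    rw [coe_list_prod_reflection] at hc
    have hv := prod_alternatingWord_mulVec hB h s t j
    rw [Matrix.mulVec_single_one] at hv
    have hv' : ∀ i, ((CoxeterSystem.alternatingWord s t j).map (reflectionMatrix B)).prod i s =
      _ := congrFun hv
    simp only [hv'] at hc
    by_cases hev : Even j
    · simp only [if_pos hev] at hc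
      rcases hc with hc | hc
      · simpa [hst] using hc s
      · have := hc t
        simp [hst.symm] at this
        linarith
    · simp only [if_neg hev] at hc
      rcases hc with hc | hc
      · simpa [hst.symm] using hc t
      · have := hc s
        simp [hst] at this
        linarith
  have hs0 : 0 ≤ Real.sin ((j + 1 : ℕ) * θ) := by
    rw [← chebyshevSeq_two_mul_cos, ← hcos]
    exact mul_nonneg hsin.le hU
  have heq : ((j + 1 : ℕ) : ℝ) * θ = Real.pi := by
    refine le_antisymm (not_lt.1 fun hlt => ?_) hk
    have := Real.sin_pos_of_pos_of_lt_pi (x := (j + 1 : ℕ) * θ - Real.pi) (by linarith)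
      (by linarith)
    rw [Real.sin_sub_pi] at this
    linarith
  refine ⟨j + 1, hk2, ?_⟩
  rw [hcos, ← heq, mul_div_cancel_left₀ _ (by positivity)]

end IntegralForm

/-! ### The reflection groups of a fusion quiver -/

namespace FusionQuiver

open GrothendieckRing

theorem form_apply_of_ne {C : Type u} [Category.{v} C] [Abelian C] [MonoidalCategory C]
    [MonoidalPreadditive C] [RigidCategory C] {V E : Type*} [DecidableEq V] [Fintype E]
    (Q : FusionQuiver C V E) {v w : V} (h : v ≠ w) :
    Q.form v w =
    - (∑ e : E with Q.src e = v ∧ Q.tgt e = w, cls (ᘁ(Q.label e)))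
      - ∑ e : E with Q.src e = w ∧ Q.tgt e = v, cls (Q.label e) := by
  simp [form, gram, h]

variable (k : Type w) [Field k] [IsAlgClosed k] {C : Type u} [Category.{v} C] [Abelian C]
  [Linear k C] [MonoidalCategory C] [MonoidalPreadditive C] [MonoidalLinear k C] [RigidCategory C]
  [FusionCategory k C] [Fintype (IrrObj C)] [DecidableEq (IrrObj C)]
  {V E : Type*} [Fintype V] [DecidableEq V] [Fintype E] (Q : FusionQuiver C V E)

variable (C V) in
/-- A matrix over the Grothendieck ring, as a real matrix in the basis of simple objects. -/
def expand : Matrix V V (GrothendieckRing C) →+* Matrix (V × IrrObj C) (V × IrrObj C) ℝ :=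
  (Matrix.compRingEquiv V (IrrObj C) ℝ).toRingHom.comp (leftMatrix k).mapMatrix

theorem expand_apply (x : Matrix V V (GrothendieckRing C)) (p q : V × IrrObj C) :
    expand k C V x p q = leftMatrix k (x p.1 q.1) p.2 q.2 := rfl

theorem expand_injective : Function.Injective (expand k C V) := by
  intro x y h
  ext i j
  refine leftMatrix_injective k ?_
  ext a b
  exact congrFun (congrFun h (i, a)) (j, b)

/-- Exchanging v and w exchanges each label with its dual, and duals act by transposes. -/
theorem leftMatrix_form_transpose (v w : V) :
    leftMatrix k (Q.form w v) = (leftMatrix k (Q.form v w)).transpose := by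
  by_cases h : v = w
  · subst h
    rw [form, gram_self, map_ofNat, ← Nat.cast_ofNat, Matrix.transpose_natCast]
  · rw [form_apply_of_ne Q h, form_apply_of_ne Q (Ne.symm h)]
    simp only [map_sub, map_neg, map_sum, leftMatrix_leftDual, Matrix.transpose_sub,
      Matrix.transpose_neg, Matrix.transpose_sum, Matrix.transpose_transpose]
    abel

theorem expand_form_isSymm : (expand k C V Q.form).IsSymm := by
  ext p q
  rw [Matrix.transpose_apply, expand_apply, expand_apply, leftMatrix_form_transpose,
    Matrix.transpose_apply]

theorem expand_form_same (v : V) (i j : IrrObj C) :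
    expand k C V Q.form (v, i) (v, j) = if i = j then 2 else 0 := by
  rw [expand_apply]
  dsimp only
  rw [form, gram_self, map_ofNat, ← Nat.cast_ofNat, Matrix.natCast_apply]
  norm_num

theorem expand_form_self (p : V × IrrObj C) : expand k C V Q.form p p = 2 := by
  simpa using Q.expand_form_same k p.1 p.2 p.2

omit [Fintype V] in
theorem leftMatrix_form_nonpos {v w : V} (h : v ≠ w) (i j : IrrObj C) :
    leftMatrix k (Q.form v w) i j ≤ 0 := by
  rw [form_apply_of_ne Q h]
  simp only [map_sub, map_neg, map_sum, Matrix.sub_apply, Matrix.neg_apply, Matrix.sum_apply]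
  have h₁ := Finset.sum_nonneg fun (e : E)
    (_ : e ∈ Finset.univ.filter fun e => Q.src e = v ∧ Q.tgt e = w) =>
      leftMatrix_cls_nonneg k (ᘁ(Q.label e)) i j
  have h₂ := Finset.sum_nonneg fun (e : E)
    (_ : e ∈ Finset.univ.filter fun e => Q.src e = w ∧ Q.tgt e = v) =>
      leftMatrix_cls_nonneg k (Q.label e) i j
  linarith

theorem expand_form_of_ne (p q : V × IrrObj C) (h : p ≠ q) :
    ∃ n : ℕ, expand k C V Q.form p q = -n := by
  obtain ⟨v, i⟩ := p
  obtain ⟨w, j⟩ := q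
  by_cases hvw : v = w
  · subst hvw
    refine ⟨0, ?_⟩
    rw [expand_form_same, if_neg (by rintro rfl; exact h rfl)]
    simp
  · have hle := Q.leftMatrix_form_nonpos k hvw i j
    rw [expand_apply]
    dsimp only
    rw [leftMatrix_apply] at hle ⊢
    refine ⟨(-coord k i (Q.form v w * cls j.1.out)).toNat, ?_⟩
    have hle' : coord k i (Q.form v w * cls j.1.out) ≤ 0 := by exact_mod_cast hle
    have : (((-coord k i (Q.form v w * cls j.1.out)).toNat : ℤ) : ℝ) =
        ((-coord k i (Q.form v w * cls j.1.out) : ℤ) : ℝ) := by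
      rw [Int.toNat_of_nonneg (by omega)]
    rw [Int.cast_natCast] at this
    rw [this]
    simp

theorem isGeometricForm_expand_form :
    (integralCoxeterMatrix _ (Q.expand_form_isSymm k)).IsGeometricForm (expand k C V Q.form) :=
  isGeometricForm_integralCoxeterMatrix _ (Q.expand_form_self k) (Q.expand_form_of_ne k)

/-- The (v, v) block of the expanded form is twice the identity, so the roots (v, i) are orthogonal,
and σ_v^Q expands to the product of their reflections. -/
theorem expand_mem {g : Matrix.GeneralLinearGroup V (GrothendieckRing C)} (hg : g ∈ Q.W) :
    Units.map (expand k C V).toMonoidHom g ∈ reflectionGroup _ (Q.expand_form_self k) := by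
  have hle : Q.W ≤ (reflectionGroup _ (Q.expand_form_self k)).comap
      (Units.map (expand k C V).toMonoidHom) := by
    refine (Subgroup.closure_le _).2 ?_
    rintro _ ⟨v, rfl⟩
    rw [SetLike.mem_coe, Subgroup.mem_comap]
    obtain ⟨g, hg, e⟩ := exists_mem_reflectionGroup_of_orthogonal (Q.expand_form_self k)
      (Finset.univ.filter fun p : V × IrrObj C => p.1 = v) (by
        rintro ⟨v', i⟩ hi ⟨w', j⟩ hj hij
        obtain rfl : v' = v := by simpa using hi
        obtain rfl : w' = v' := by simpa using hj
        rw [expand_form_same, if_neg (by rintro rfl; exact hij rfl)])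
    convert hg
    ext1
    rw [e]
    change expand k C V (1 - _) = _
    rw [map_sub, map_one]
    congr 1
    ext p q
    rw [expand_apply]
    by_cases hp : p.1 = v
    · simp [hp, expand_apply]
    · simp [hp]
  exact hle hg

variable {k} {fp : GrothendieckRing C →+* ℝ} {d : IrrObj C → ℝ}

section Columns

variable (hd : ∀ i, 0 < d i) (h : ∀ x, (leftMatrix k x).mulVec d = fp x • d)

include hd h

/-- d is also a left eigenvector; this carries signs of expanded columns over to FPdim. -/
theorem sum_mul_expand (x : Matrix V V (GrothendieckRing C)) (u v : V) (j : IrrObj C) :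
    ∑ i, d i * expand k C V x (u, i) (v, j) = fp (x u v) * d j :=
  congrFun (vecMul_character hd h (x u v)) j

theorem character_nonneg {x : Matrix V V (GrothendieckRing C)} {v : V} {j : IrrObj C}
    (hx : ∀ p, 0 ≤ expand k C V x p (v, j)) (u : V) : 0 ≤ fp (x u v) := by
  refine nonneg_of_mul_nonneg_left ?_ (hd j)
  rw [← sum_mul_expand hd h]
  exact Finset.sum_nonneg fun i _ => mul_nonneg (hd i).le (hx _)

theorem character_nonpos {x : Matrix V V (GrothendieckRing C)} {v : V} {j : IrrObj C}
    (hx : ∀ p, expand k C V x p (v, j) ≤ 0) (u : V) : fp (x u v) ≤ 0 := by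
  have := character_nonneg hd h (x := -x) (v := v) (j := j)
    (fun p => by rw [map_neg, Matrix.neg_apply]; exact neg_nonneg.2 (hx p)) u
  rw [Matrix.neg_apply, map_neg] at this
  exact neg_nonneg.1 this

theorem character_col {g : Matrix.GeneralLinearGroup V (GrothendieckRing C)} (hg : g ∈ Q.W)
    (v : V) : (∀ u, 0 ≤ fp (g.1 u v)) ∨ ∀ u, fp (g.1 u v) ≤ 0 := by
  obtain ⟨j⟩ := nonempty_irrObj k (C := C)
  exact ((Q.isGeometricForm_expand_form k).reflectionGroup_col (Q.expand_mem k hg) (v, j)).imp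
    (character_nonneg hd h) (character_nonpos hd h)

theorem eq_one_of_character_eq_one {g : Matrix.GeneralLinearGroup V (GrothendieckRing C)}
    (hg : g ∈ Q.W) (h₁ : g.1.map fp = 1) : g = 1 := by
  have hone : Units.map (expand k C V).toMonoidHom g = 1 := by
    refine (Q.isGeometricForm_expand_form k).reflectionGroup_eq_one (Q.expand_mem k hg) ?_
    rintro p ⟨v, j⟩
    refine ((Q.isGeometricForm_expand_form k).reflectionGroup_col (Q.expand_mem k hg)
      (v, j)).resolve_right (fun hneg => ?_) p
    -- A nonpositive column would make the diagonal FPdim nonpositive, whereas it is 1.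
    have := character_nonpos hd h hneg v
    have e := congrFun (congrFun h₁ v) v
    rw [Matrix.map_apply, Matrix.one_apply_eq] at e
    linarith
  ext1
  exact expand_injective k ((congrArg Units.val hone).trans (map_one (expand k C V)).symm)

theorem map_form : Q.form.map fp = Q.realForm k := by
  ext v w
  by_cases hvw : v = w
  · subst hvw
    rw [Matrix.map_apply, form, realForm, gram_self, gram_self, map_ofNat]
  · rw [Matrix.map_apply, form_apply_of_ne Q hvw]
    simp [realForm, gram, hvw, character_cls hd h]

theorem map_sigma (v : V) : Units.map fp.mapMatrix.toMonoidHom (Q.sigma v) = Q.realSigma k v := by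
  ext i j
  change fp ((reflectionMatrix Q.form v) i j) = reflectionMatrix (Q.realForm k) v i j
  rw [← Q.map_form hd h]
  simp only [reflectionMatrix, Matrix.sub_apply, Matrix.one_apply, Matrix.of_apply, map_sub,
    Matrix.map_apply]
  split_ifs <;> simp

theorem map_W : Q.W.map (Units.map fp.mapMatrix.toMonoidHom) = Q.realW k := by
  unfold W realW reflectionGroup
  rw [MonoidHom.map_closure, ← Set.range_comp]
  congr 2
  ext1 v
  exact Q.map_sigma hd h v

omit [Fintype V] in
theorem realForm_eq {v w : V} (hvw : v ≠ w) : Q.realForm k v w = -Q.graphLabel k v w := by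
  classical
  have hdisj : Disjoint (Finset.univ.filter fun e : E => Q.src e = v ∧ Q.tgt e = w)
      (Finset.univ.filter fun e : E => Q.src e = w ∧ Q.tgt e = v) := by
    rw [Finset.disjoint_filter]
    rintro e - ⟨h₁, -⟩ ⟨h₂, -⟩
    exact hvw (h₁.symm.trans h₂)
  rw [graphLabel, Finset.filter_or, Finset.sum_union hdisj]
  simp only [realForm, gram, Matrix.of_apply, if_neg hvw, ← character_cls hd h,
    character_leftDual hd h]
  ring

/-- Column v of σ_w has the entry 1 at v and the label at w, and these have the same sign. -/
theorem graphLabel_nonneg {v w : V} (hvw : v ≠ w) : 0 ≤ Q.graphLabel k v w := by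
  have hc := Q.character_col hd h (Q.sigma_mem w) v
  have e : ∀ u, fp ((Q.sigma w).1 u v) = (Q.realSigma k w).1 u v := fun u => by
    rw [← Q.map_sigma hd h w]
    rfl
  simp only [e] at hc
  have e₁ : (Q.realSigma k w).1 v v = 1 := by
    change reflectionMatrix _ _ _ _ = _
    simp [reflectionMatrix, hvw]
  have e₂ : (Q.realSigma k w).1 w v = Q.graphLabel k v w := by
    change reflectionMatrix _ _ _ _ = _
    simp [reflectionMatrix, hvw.symm, Q.realForm_eq hd h hvw.symm, Q.graphLabel_comm k w v]
  rcases hc with hc | hc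
  · exact e₂ ▸ hc w
  · have := hc v
    rw [e₁] at this
    linarith

theorem isGeometricForm_realForm : (Q.coxeterGraph k).IsGeometricForm (Q.realForm k) := by
  have hsymm : (Q.realForm k).IsSymm := by
    ext v w
    by_cases hvw : v = w
    · subst hvw; rfl
    · rw [Matrix.transpose_apply, Q.realForm_eq hd h hvw, Q.realForm_eq hd h (Ne.symm hvw),
        Q.graphLabel_comm]
  have hcol : ∀ g ∈ Q.realW k, ∀ j, (∀ i, 0 ≤ g.1 i j) ∨ ∀ i, g.1 i j ≤ 0 := by
    intro g hg j
    rw [← Q.map_W hd h] at hg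
    obtain ⟨g, hg, rfl⟩ := hg
    exact Q.character_col hd h hg j
  have hM : ∀ {v w}, v ≠ w → Q.coxeterGraph k v w = coxeterLabel (Q.graphLabel k v w) :=
    fun hvw => if_neg hvw
  -- Nonemptiness matters because `sInf ∅ = 0` would be read as the label ∞.
  have hne : ∀ {v w}, v ≠ w → ¬2 ≤ Q.graphLabel k v w →
      {m : ℕ | 2 ≤ m ∧ Q.graphLabel k v w = 2 * Real.cos (Real.pi / m)}.Nonempty := by
    intro v w hvw hlt
    have e : -Q.realForm k v w = Q.graphLabel k v w := by rw [Q.realForm_eq hd h hvw, neg_neg]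
    have := exists_eq_two_mul_cos hsymm (Q.gram_self _) hcol hvw
      (by rw [e]; exact Q.graphLabel_nonneg hd h hvw) (by rw [e]; exact not_le.1 hlt)
    rwa [e] at this
  refine ⟨hsymm, Q.gram_self _, fun v w hvw h0 => ?_, fun v w h0 => ?_⟩
  · rw [hM hvw] at h0 ⊢
    unfold coxeterLabel at h0 ⊢
    split_ifs at h0 ⊢ with h2
    · exact absurd rfl h0
    · rw [Q.realForm_eq hd h hvw, neg_mul]
      exact congrArg Neg.neg (Nat.sInf_mem (hne hvw h2)).2
  · have hvw : v ≠ w := by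
      rintro rfl
      rw [(Q.coxeterGraph k).diagonal] at h0
      exact one_ne_zero h0
    rw [Q.realForm_eq hd h hvw]
    rw [hM hvw] at h0
    unfold coxeterLabel at h0
    split_ifs at h0 with h2
    · linarith
    · have := (Nat.sInf_mem (hne hvw h2)).1
      omega

end Columns

end FusionQuiver

end

/-! ### Assembly of the two isomorphisms -/

theorem mainTheorem9 {k : Type w} [Field k] [IsAlgClosed k]
    {C : Type u} [Category.{v} C] [Abelian C] [Linear k C] [MonoidalCategory C]
    [MonoidalPreadditive C] [MonoidalLinear k C] [RigidCategory C] [FusionCategory k C]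
    {V E : Type*} [Fintype V] [DecidableEq V] [Fintype E] (Q : FusionQuiver C V E) :
    ∃ (fp : GrothendieckRing C →+* ℝ)
      (f : (Q.coxeterGraph k).Group ≃* Q.W)
      (g : Q.W ≃* Q.realW k),
      (∀ X : C, fp (GrothendieckRing.cls X) = FPdim k X) ∧
      (∀ v : V, f ((Q.coxeterGraph k).simple v) = ⟨Q.sigma v, Q.sigma_mem v⟩) ∧
      (∀ v : V, g ⟨Q.sigma v, Q.sigma_mem v⟩ = ⟨Q.realSigma k v, Q.realSigma_mem k v⟩) ∧
      (∀ x : Q.W, (g x).1.1 = x.1.1.map fp) := by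
  classical
  have := finite_irrObj k (C := C)
  have := Fintype.ofFinite (IrrObj C)
  obtain ⟨fp, d, hd, h⟩ := GrothendieckRing.exists_character k C
  have hgeom := Q.isGeometricForm_realForm hd h
  let φ : Matrix.GeneralLinearGroup V (GrothendieckRing C) →* Matrix.GeneralLinearGroup V ℝ :=
    Units.map fp.mapMatrix.toMonoidHom
  have hφ : ∀ x : Q.W, φ x ∈ Q.realW k := fun x => Q.map_W hd h ▸ Subgroup.mem_map_of_mem φ x.2
  let ψ : Q.W →* Q.realW k := (φ.comp Q.W.subtype).codRestrict (Q.realW k) hφ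
  have hinj : Function.Injective ψ := by
    rw [injective_iff_map_eq_one]
    intro x hx
    exact Subtype.ext (Q.eq_one_of_character_eq_one hd h x.2
      (congrArg (fun y : Q.realW k => y.1.1) hx))
  have hsurj : Function.Surjective ψ := by
    rintro ⟨y, hy⟩
    rw [← Q.map_W hd h] at hy
    obtain ⟨x, hx, rfl⟩ := hy
    exact ⟨⟨x, hx⟩, rfl⟩
  let g : Q.W ≃* Q.realW k := MulEquiv.ofBijective ψ ⟨hinj, hsurj⟩
  have hg : ∀ v : V, g ⟨Q.sigma v, Q.sigma_mem v⟩ = ⟨Q.realSigma k v, Q.realSigma_mem k v⟩ :=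
    fun v => Subtype.ext (Q.map_sigma hd h v)
  -- The geometric representation of Γ_Q is faithful with image W(|Q|); the first isomorphism is
  -- obtained by following it with the inverse of g.
  let e : (Q.coxeterGraph k).Group ≃* Q.realW k :=
    (MonoidHom.ofInjective hgeom.rep_injective).trans (MulEquiv.subgroupCongr hgeom.range_rep)
  refine ⟨fp, e.trans g.symm, g, GrothendieckRing.character_cls hd h, fun v => ?_, hg, fun x => rfl⟩
  rw [MulEquiv.trans_apply, MulEquiv.symm_apply_eq, hg]
  exact Subtype.ext (hgeom.rep_simple v)
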